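/- **Setting.** Let $h_b(x)=-x\log x-(1-x)\log(1-x)$, $h_D(x_1,x_2)=2h_b\big(\tfrac{x_1+x_2}{2}\big)-h_b(x_1)-h_b(x_2)$ on $[0,1]^2$, and $h_D^{-1}(y\,|\,c)=\sup\{x\in[0,1]: h_D(x,c)\le y\}$ for $c\in[0,1]$, $y\ge 0$. Let $1\le r\le M\le K$ and let $\nu_1,\dots,\nu_M$ be probability distributions on $\mathbb R^d\times\{-1,+1\}$ such that the feature $X$ satisfies $\|X-a_m\|\le\rho$ almost surely under $\nu_m$, where $a_m\in\mathbb R^d$ and $\rho>0$. For $k=1,\dots,K$ put $c_k=(k \bmod (M-r+1))+1$ and $I_k=\{c_k,\dots,c_k+r-1\}$. In the $r$-th setup client $k$ has data distribution $\mu_k=\sum_{m\in I_k}\alpha_{k,m}\nu_m$, where the given coefficients $\alpha_{k,m}\ge 0$ satisfy $\alpha_{k,m}=0$ for $m\notin I_k$, $\sum_{m\in I_k}\alpha_{k,m}=1$ for all $k$, $\sum_{k=1}^K\alpha_{k,m}=K/M$ for all $m$, and $\alpha_{k,\cdot}=\alpha_{k',\cdot}$ if $c_k=c_{k'}$. Client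 $k$ draws $S_k=(Z_{k,1},\dots,Z_{k,n})\sim\mu_k^{\otimes n}$, independently of the other clients, and produces from $S_k$ alone, by a possibly randomized algorithm, the weight vector $W_k\in\mathbb R^d$, $\|W_k\|\le 1$, of a linear classifier (for example by a normalized SVM). Let $\overline W=\frac1K\sum_k W_k$, $\ell_\theta((x,y),w)=\mathbb 1\{y\langle x,w\rangle<\theta\}$, $$\hat{\mathcal L}_\theta(S_{[K]},w)=\frac1{nK}\sum_{k=1}^K\sum_{i=1}^n\ell_\theta(Z_{k,i},w),\qquad \mathrm{gen}_\theta(S_{[K]},w)=\frac1K\sum_{k=1}^K\mathbb E_{Z\sim\mu_k}[\ell_0(Z,w)]-\hat{\mathcal L}_\theta(S_{[K]},w).$$ Put $\rho_k=\rho+\max_{i,j\in I_k}\|a_i-a_j\|$, $b_k=\sum_{m\in I_k}\alpha_{k,m}a_m$, $\hat L=\mathbb E[\hat{\mathcal L}_\theta(S_{[K]},\overline W)]$, and $$\hat E=\frac1{nK}\sum_{k=1}^K\left[\Big(\frac{\rho_k}{K\theta}\Big)^2\log(nK)\,\log\max\Big(3,\frac{K\theta}{\rho_k}\Big)+\log\max\Big(1,\frac{4n\|b_k\|}{K\theta}\Big)\right].$$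 **Theorem.** (1) There are universal constants $C>0$ and $N_0\in\mathbb N$ such that for all such data, every $\theta\in(0,1]$ and all $n\ge 2$ with $nK\ge N_0$, $$\mathbb E[\mathrm{gen}_\theta(S_{[K]},\overline W)]\le C\left(h_D^{-1}\Big(\hat E+\frac{\log n}{n}\,\Big|\,\max\Big(0,\hat L-\frac{9}{nK\sqrt K}\Big)\Big)-\hat L+\frac1{nK\sqrt K}\right).$$ (2) In particular, the bound is fast when the empirical risk is negligible: for all real $B,\Lambda$ there is a constant $C>0$, depending only on $B$ and $\Lambda$, such that for all such data, every $\theta\in(0,1]$ and all $n\ge2$ with $\rho_k\le B\theta$ and $\|b_k\|\le B\theta$ for all $k$, if $\hat L\le\Lambda\,R$ then $\mathbb E[\mathrm{gen}_\theta(S_{[K]},\overline W)]\le C\,R$, where $R=\frac{\log K\,\log(nK)}{nK^2}+\frac{\log n}{n}$. -/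

import Mathlib

open MeasureTheory ProbabilityTheory
open scoped NNReal InnerProductSpace

noncomputable section

namespace DSVM

/-- The function `h_D (x₁, x₂) = 2 h_b ((x₁ + x₂) / 2) - h_b x₁ - h_b x₂`, where `h_b` is the binary
entropy function (natural logarithm). It is only evaluated on `[0, 1] × [0, 1]` below. -/
def hD (x₁ x₂ : ℝ) : ℝ :=
  2 * Real.binEntropy ((x₁ + x₂) / 2) - Real.binEntropy x₁ - Real.binEntropy x₂

/-- The inverse function `h_D⁻¹ (y | c) = sup {x ∈ [0, 1] : h_D (x, c) ≤ y}`. For `c ∈ [0, 1]` and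
`0 ≤ y` the set contains `c`, so this is a supremum of a nonempty bounded set. -/
def hDInv (y c : ℝ) : ℝ := sSup {x : ℝ | x ∈ Set.Icc (0 : ℝ) 1 ∧ hD x c ≤ y}

/-- The feature space, which is also the hypothesis space: `ℝ^d` with its Euclidean norm. -/
abbrev Feat (d : ℕ) : Type := EuclideanSpace ℝ (Fin d)

/-- The label set `{-1, +1}`. -/
abbrev Label : Type := ↥({-1, 1} : Set ℝ)

/-- A labelled sample `z = (x, y)`. -/
abbrev Sample (d : ℕ) : Type := Feat d × Label

/-- The `0`-`1` loss with margin `θ` of the linear classifier `f (x, w) = ⟪x, w⟫`: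
it is `1` if `y * f (x, w) < θ`, and `0` otherwise. For `θ = 0` this is the `0`-`1` loss. -/
def marginLoss {d : ℕ} (θ : ℝ) (z : Sample d) (w : Feat d) : ℝ :=
  open scoped Classical in if (z.2 : ℝ) * ⟪z.1, w⟫_ℝ < θ then 1 else 0

/-- The population risk of `w` under the data distribution `μ`, for the `0`-`1` loss. -/
def popRisk {d : ℕ} (μ : Measure (Sample d)) (w : Feat d) : ℝ :=
  ∫ z, marginLoss 0 z w ∂μ

/-- The empirical risk of `w` on the dataset `s`, for the `0`-`1` loss with margin `θ`. -/
def empRisk {d n : ℕ} (θ : ℝ) (s : Fin n → Sample d) (w : Feat d) : ℝ :=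
  (1 / (n : ℝ)) * ∑ i, marginLoss θ (s i) w

/-- The index set of the `r` consecutive balls from which client `k` picks its data.
With indices `m, k` counted from `1` this is `{c, …, c + r - 1}`, `c = (k mod (M - r + 1)) + 1`.
Here `m : Fin M` and `k : Fin K` are counted from `0`. -/
def window {K : ℕ} (M r : ℕ) (k : Fin K) : Finset (Fin M) :=
  Finset.univ.filter fun m =>
    ((k : ℕ) + 1) % (M - r + 1) ≤ (m : ℕ) ∧ (m : ℕ) < ((k : ℕ) + 1) % (M - r + 1) + r

/-- The `r`-th setup of distributed linear classification with `K` clients, `n` training samples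
per client, features in `ℝ^d`, and `M` base distributions supported on balls of radius `ρ`,
together with the learning algorithms of the clients. -/
structure Setup (d n K M r : ℕ) where
  /-- There are at least as many clients as base distributions. -/
  M_le_K : M ≤ K
  /-- The index of the setup lies in `{1, …, M}`. -/
  one_le_r : 1 ≤ r
  r_le_M : r ≤ M
  /-- The base data distributions. -/
  ν : Fin M → Measure (Sample d)
  isProb : ∀ m, IsProbabilityMeasure (ν m)
  /-- The centers and the radius of the balls that support the features. -/
  a : Fin M → Feat d
  ρ : ℝ
  ρ_pos : 0 < ρ
  supp : ∀ m, ∀ᵐ z ∂(ν m), ‖z.1 - a m‖ ≤ ρ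
  /-- The mixture coefficients. -/
  α : Fin K → Fin M → ℝ≥0
  α_outside : ∀ k m, m ∉ window M r k → α k m = 0
  α_row : ∀ k, ∑ m ∈ window M r k, α k m = 1
  /-- The average of the client distributions is the average of the base distributions. -/
  α_col : ∀ m, ∑ k, α k m = (K : ℝ≥0) / (M : ℝ≥0)
  α_congr : ∀ k k' : Fin K, window M r k = window M r k' → α k = α k'
  /-- The possibly stochastic learning algorithms `P_{W_k | S_k}`. -/
  alg : Fin K → Kernel (Fin n → Sample d) (Feat d)
  alg_markov : ∀ k, IsMarkovKernel (alg k)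
  /-- The hypotheses are normalized: they have norm at most one. -/
  alg_ball : ∀ k s, ∀ᵐ w ∂(alg k s), ‖w‖ ≤ 1

namespace Setup

variable {d n K M r : ℕ} (P : Setup d n K M r)

/-- The data distribution of client `k`: a mixture of the `r` base distributions in its window. -/
def μ (k : Fin K) : Measure (Sample d) := ∑ m ∈ window M r k, P.α k m • P.ν m

/-- The largest distance between two centers in the window of client `k`. -/
def D (k : Fin K) : ℝ :=
  ((window M r k ×ˢ window M r k).sup fun p => ‖P.a p.1 - P.a p.2‖₊ : ℝ≥0)

/-- The effective radius of the data of client `k`. -/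
def ρk (k : Fin K) : ℝ := P.ρ + P.D k

/-- The weighted center of the data of client `k`. -/
def b (k : Fin K) : Feat d := ∑ m ∈ window M r k, (P.α k m : ℝ) • P.a m

/-- The joint law of `(S_k, W_k)`, `k = 1, …, K`: the clients are independent, the `n` samples of
client `k` are i.i.d. with law `μ_k`, and `W_k` is drawn from `P_{W_k | S_k}`. -/
def law : Measure (Fin K → (Fin n → Sample d) × Feat d) :=
  Measure.pi fun k => (Measure.pi fun _ : Fin n => P.μ k) ⊗ₘ P.alg k

/-- The aggregated hypothesis: the arithmetic average of the hypotheses of the clients. -/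
def avg (ω : Fin K → (Fin n → Sample d) × Feat d) : Feat d := (1 / (K : ℝ)) • ∑ k, (ω k).2

/-- The margin generalization error: the average over the clients of the difference of
the population risk (`0`-`1` loss) and the empirical risk (margin `θ`) of `w`. -/
def gen (θ : ℝ) (s : Fin K → Fin n → Sample d) (w : Feat d) : ℝ :=
  (1 / (K : ℝ)) * ∑ k, (popRisk (P.μ k) w - empRisk θ (s k) w)

/-- The expected margin generalization error of the aggregated hypothesis. -/
def expGen (θ : ℝ) : ℝ := ∫ ω, P.gen θ (fun k => (ω k).1) (avg ω) ∂P.law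

/-- The expected empirical margin risk of the aggregated hypothesis, averaged over the clients. -/
def expEmp (θ : ℝ) : ℝ :=
  ∫ ω, (1 / (K : ℝ)) * ∑ k, empRisk θ (ω k).1 (avg ω) ∂P.law

/-- The rate term. -/
def Ehat (θ : ℝ) : ℝ :=
  (1 / ((n : ℝ) * K)) * ∑ k : Fin K,
    ((P.ρk k / (K * θ)) ^ 2 * Real.log (n * K) * Real.log (max 3 (K * θ / P.ρk k))
      + Real.log (max 1 (4 * n * ‖P.b k‖ / (K * θ))))

end Setup

/-- The quantity `1 / (n K √K)`. -/
def eps (n K : ℕ) : ℝ := 1 / ((n : ℝ) * K * Real.sqrt K)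

/-- The rate `log K * log (n K) / (n K²) + log n / n`. -/
def fastRate (n K : ℕ) : ℝ :=
  Real.log K * Real.log ((n : ℝ) * K) / ((n : ℝ) * (K : ℝ) ^ 2) + Real.log n / n

end DSVM

end

namespace DSVM

/-! Fix a client `k` and freeze the others. The aggregate is `u + W_k / K` with `u` independent of
`S_k`, so a margin `θ` for the aggregate leaves a tolerance of order `K θ` for the scores of `W_k`.
This is the gain from averaging: on the sample and an independent ghost sample, `W_k` can be
replaced by a very coarse description. The perceptron argument (`exists_sparse_approx`) approximates
it by a signed sum of about `(ρ_k / (K θ))²` centred sample points, and the scalar `⟪b_k, W_k⟫` is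
rounded to a grid (`exists_code`). Since every vector of the unit ball is covered, the way in which
the algorithm uses its data is irrelevant.

The resulting finite class depends on the double sample, but equivariantly under permutations of it.
For each code, averaging over all permutations bounds the mean of `exp (n h_D)` of the two error
frequencies by a polynomial in `n`, because a hypergeometric probability is governed by `h_D`
(`exp_mul_hD_le`, `lintegral_sum_expHD_le`). Summing over codes costs only their number.

The passage to expectations uses supporting affine functions of the convex `h_D`. Above the diagonal
they increase in the first variable and decrease in the second (`exists_tangent`), which is what the
one-sided comparison of margins with codes requires. An affine function commutes with expectation
and with the average over clients, so Jensen for the exponential gives `hD_expPop_le_rate`: `h_D` of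
the mean population and empirical risks is at most the averaged log-moment `rate`.

Part (1) then moves constants and shifts through the inverse of `h_D` (`sub_le_mul_hDInv`). Part (2)
uses that `h_D (x, c)` is at least linear in `x` once `c ≤ x / 2` (`le_max_of_hD_le`). -/

/-! ### Convexity of `hD` and elementary bounds -/

theorem hD_eq_mul_log (x c : ℝ) : hD x c =
    (x * (Real.log x - Real.log ((x + c) / 2)) + c * (Real.log c - Real.log ((x + c) / 2))) +
    ((1 - x) * (Real.log (1 - x) - Real.log (1 - (x + c) / 2)) +
      (1 - c) * (Real.log (1 - c) - Real.log (1 - (x + c) / 2))) := by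
  simp only [hD, Real.binEntropy, Real.log_inv]
  ring

theorem continuous_hD : Continuous fun p : ℝ × ℝ => hD p.1 p.2 := by
  unfold hD
  have := Real.binEntropy_continuous
  fun_prop

@[simp] theorem hD_self (c : ℝ) : hD c c = 0 := by
  simp only [hD]
  rw [show (c + c) / 2 = c by ring]
  ring

theorem hD_one_zero : hD 1 0 = 2 * Real.log 2 := by
  simp [hD]

/-- One summand of the log-sum inequality. -/
theorem sub_le_mul_log_sub {x m a b : ℝ} (hx : 0 ≤ x) (hm : x = 0 ∨ 0 < m) (hm0 : 0 ≤ m)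
    (ha : 0 < a) (hb : 0 < b) :
    x - m * a / b ≤ x * (Real.log x - Real.log m - (Real.log a - Real.log b)) := by
  rcases hx.eq_or_lt with h | h
  · subst h
    have : 0 ≤ m * a / b := by positivity
    simpa using this
  · have hm' : 0 < m := hm.resolve_left h.ne'
    have h1 := Real.one_sub_inv_le_log_of_pos (x := x * b / (m * a)) (by positivity)
    rw [Real.log_div (by positivity) (by positivity), Real.log_mul h.ne' hb.ne',
      Real.log_mul hm'.ne' ha.ne'] at h1
    have h2 := mul_le_mul_of_nonneg_left h1 h.le
    have h3 : x * (1 - (x * b / (m * a))⁻¹) = x - m * a / b := by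
      field_simp
    rw [h3] at h2
    linarith

/-- The corrections in `sub_le_mul_log_sub` for `x` and for `c` add up to `x + c` and cancel. The
left side is linear in `(x, c)`, so it serves as a tangent plane at `(A, B)`. -/
theorem logSum_two {x c A B : ℝ} (hx : 0 ≤ x) (hc : 0 ≤ c) (hA : 0 < A) (hB : 0 < B) :
    x * (Real.log A - Real.log ((A + B) / 2)) + c * (Real.log B - Real.log ((A + B) / 2)) ≤
    x * (Real.log x - Real.log ((x + c) / 2)) + c * (Real.log c - Real.log ((x + c) / 2)) := by
  have h1 := sub_le_mul_log_sub (x := x) (m := (x + c) / 2) (a := A) (b := (A + B) / 2) hx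
    (by rcases hx.eq_or_lt with h | h
        · exact Or.inl h.symm
        · exact Or.inr (by positivity)) (by positivity) hA (by positivity)
  have h2 := sub_le_mul_log_sub (x := c) (m := (x + c) / 2) (a := B) (b := (A + B) / 2) hc
    (by rcases hc.eq_or_lt with h | h
        · exact Or.inl h.symm
        · exact Or.inr (by positivity)) (by positivity) hB (by positivity)
  have h3 : (x + c) / 2 * A / ((A + B) / 2) + (x + c) / 2 * B / ((A + B) / 2) = x + c := by
    field_simp
  linarith

/-- Affine minorant of `hD` that touches it at an interior point of the unit square. -/
theorem hD_tangent {x c A B : ℝ} (hx : x ∈ Set.Icc (0 : ℝ) 1) (hc : c ∈ Set.Icc (0 : ℝ) 1)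
    (hA : A ∈ Set.Ioo (0 : ℝ) 1) (hB : B ∈ Set.Ioo (0 : ℝ) 1) :
    (x * (Real.log A - Real.log ((A + B) / 2)) + c * (Real.log B - Real.log ((A + B) / 2))) +
    ((1 - x) * (Real.log (1 - A) - Real.log (1 - (A + B) / 2)) +
      (1 - c) * (Real.log (1 - B) - Real.log (1 - (A + B) / 2))) ≤ hD x c := by
  rw [hD_eq_mul_log]
  have h1 := logSum_two hx.1 hc.1 hA.1 hB.1
  have h2 := logSum_two (x := 1 - x) (c := 1 - c) (A := 1 - A) (B := 1 - B) (by linarith [hx.2])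
    (by linarith [hc.2]) (by linarith [hA.2]) (by linarith [hB.2])
  rw [show (1 - A + (1 - B)) / 2 = 1 - (A + B) / 2 by ring,
    show (1 - x + (1 - c)) / 2 = 1 - (x + c) / 2 by ring] at h2
  linarith

theorem hD_nonneg {x c : ℝ} (hx : x ∈ Set.Icc (0 : ℝ) 1) (hc : c ∈ Set.Icc (0 : ℝ) 1) :
    0 ≤ hD x c := by
  have := hD_tangent hx hc (A := 1 / 2) (B := 1 / 2) (by norm_num) (by norm_num)
  norm_num at this
  linarith

/-- A supporting affine functional above the diagonal is increasing in the first argument and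
decreasing in the second. -/
theorem exists_tangent {A B : ℝ} (hB : 0 < B) (hBA : B ≤ A) (hA : A < 1) :
    ∃ p q t : ℝ, 0 ≤ p ∧ q ≤ 0 ∧ p * A + q * B + t = hD A B ∧
      ∀ x ∈ Set.Icc (0 : ℝ) 1, ∀ c ∈ Set.Icc (0 : ℝ) 1, p * x + q * c + t ≤ hD x c := by
  refine ⟨(Real.log A - Real.log ((A + B) / 2)) - (Real.log (1 - A) - Real.log (1 - (A + B) / 2)),
    (Real.log B - Real.log ((A + B) / 2)) - (Real.log (1 - B) - Real.log (1 - (A + B) / 2)),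
    (Real.log (1 - A) - Real.log (1 - (A + B) / 2)) +
      (Real.log (1 - B) - Real.log (1 - (A + B) / 2)), ?_, ?_, ?_, ?_⟩
  · have h1 := Real.log_le_log (x := (A + B) / 2) (y := A) (by linarith) (by linarith)
    have h2 := Real.log_le_log (x := 1 - A) (y := 1 - (A + B) / 2) (by linarith) (by linarith)
    linarith
  · have h1 := Real.log_le_log (x := B) (y := (A + B) / 2) (by linarith) (by linarith)
    have h2 := Real.log_le_log (x := 1 - (A + B) / 2) (y := 1 - B) (by linarith) (by linarith)
    linarith
  · rw [hD_eq_mul_log]; ring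
  · intro x hx c hc
    refine le_trans (le_of_eq ?_) (hD_tangent hx hc (A := A) (B := B)
      ⟨by linarith, hA⟩ ⟨hB, by linarith⟩)
    ring

theorem hD_convex_of_interior {x₀ c₀ x₁ c₁ s t : ℝ} (hx₀ : x₀ ∈ Set.Ioo (0 : ℝ) 1)
    (hc₀ : c₀ ∈ Set.Ioo (0 : ℝ) 1) (hx₁ : x₁ ∈ Set.Ioo (0 : ℝ) 1) (hc₁ : c₁ ∈ Set.Ioo (0 : ℝ) 1)
    (hs : 0 ≤ s) (ht : 0 ≤ t) (hst : s + t = 1) :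
    hD (s * x₀ + t * x₁) (s * c₀ + t * c₁) ≤ s * hD x₀ c₀ + t * hD x₁ c₁ := by
  have hA : s * x₀ + t * x₁ ∈ Set.Ioo (0 : ℝ) 1 := convex_Ioo (0 : ℝ) 1 hx₀ hx₁ hs ht hst
  have hB : s * c₀ + t * c₁ ∈ Set.Ioo (0 : ℝ) 1 := convex_Ioo (0 : ℝ) 1 hc₀ hc₁ hs ht hst
  have h0 := mul_le_mul_of_nonneg_left (hD_tangent (Set.Ioo_subset_Icc_self hx₀)
    (Set.Ioo_subset_Icc_self hc₀) hA hB) hs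
  have h1 := mul_le_mul_of_nonneg_left (hD_tangent (Set.Ioo_subset_Icc_self hx₁)
    (Set.Ioo_subset_Icc_self hc₁) hA hB) ht
  refine le_trans (le_of_eq ?_) (add_le_add h0 h1)
  rw [hD_eq_mul_log]
  obtain rfl : t = 1 - s := by linarith
  ring

/-- `hD` is jointly convex on the unit square. -/
theorem hD_convex {x₀ c₀ x₁ c₁ s t : ℝ} (hx₀ : x₀ ∈ Set.Icc (0 : ℝ) 1)
    (hc₀ : c₀ ∈ Set.Icc (0 : ℝ) 1) (hx₁ : x₁ ∈ Set.Icc (0 : ℝ) 1) (hc₁ : c₁ ∈ Set.Icc (0 : ℝ) 1)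
    (hs : 0 ≤ s) (ht : 0 ≤ t) (hst : s + t = 1) :
    hD (s * x₀ + t * x₁) (s * c₀ + t * c₁) ≤ s * hD x₀ c₀ + t * hD x₁ c₁ := by
  have hcl : IsClosed {p : (ℝ × ℝ) × (ℝ × ℝ) | hD (s * p.1.1 + t * p.2.1) (s * p.1.2 + t * p.2.2) ≤
      s * hD p.1.1 p.1.2 + t * hD p.2.1 p.2.2} := by
    refine isClosed_le ?_ ?_
    · exact continuous_hD.comp (by fun_prop : Continuous fun p : (ℝ × ℝ) × (ℝ × ℝ) =>
        (s * p.1.1 + t * p.2.1, s * p.1.2 + t * p.2.2))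
    · exact ((continuous_hD.comp continuous_fst).const_mul s).add
        ((continuous_hD.comp continuous_snd).const_mul t)
  have hsub : (Set.Ioo (0 : ℝ) 1 ×ˢ Set.Ioo (0 : ℝ) 1) ×ˢ (Set.Ioo (0 : ℝ) 1 ×ˢ Set.Ioo (0 : ℝ) 1) ⊆
      {p : (ℝ × ℝ) × (ℝ × ℝ) | hD (s * p.1.1 + t * p.2.1) (s * p.1.2 + t * p.2.2) ≤
      s * hD p.1.1 p.1.2 + t * hD p.2.1 p.2.2} :=
    fun p hp => hD_convex_of_interior hp.1.1 hp.1.2 hp.2.1 hp.2.2 hs ht hst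
  have h := closure_minimal hsub hcl
  simp only [closure_prod_eq, closure_Ioo (zero_ne_one' ℝ)] at h
  exact h (a := ((x₀, c₀), (x₁, c₁))) ⟨⟨hx₀, hc₀⟩, ⟨hx₁, hc₁⟩⟩

/-- Convexity along the ray to the origin, where `hD` vanishes. This later shifts the second
argument. -/
theorem hD_smul_le {x c s : ℝ} (hx : x ∈ Set.Icc (0 : ℝ) 1) (hc : c ∈ Set.Icc (0 : ℝ) 1)
    (hs : 0 ≤ s) (hs1 : s ≤ 1) : hD (s * x) (s * c) ≤ s * hD x c := by
  have h := hD_convex hx hc (x₁ := 0) (c₁ := 0) (by simp) (by simp) hs (sub_nonneg.2 hs1) (by ring)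
  simpa using h

theorem hD_segment_le {x c s : ℝ} (hx : x ∈ Set.Icc (0 : ℝ) 1) (hc : c ∈ Set.Icc (0 : ℝ) 1)
    (hs : 0 ≤ s) (hs1 : s ≤ 1) : hD (c + s * (x - c)) c ≤ s * hD x c := by
  have h := hD_convex hx hc hc hc hs (sub_nonneg.2 hs1) (by ring)
  rw [show s * x + (1 - s) * c = c + s * (x - c) by ring,
    show s * c + (1 - s) * c = c by ring] at h
  simpa using h

/-- The point `(x, c)` is a mixture of a diagonal point `(p, p)`, where `hD` vanishes, and the
corner `(1, 0)`, where it is `2 log 2`, with weight `x - c` on the corner. At the corner itself `p`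
is undefined, hence the separate case. -/
theorem hD_le_two_mul_sub {x c : ℝ} (hx : x ∈ Set.Icc (0 : ℝ) 1) (hc : c ∈ Set.Icc (0 : ℝ) 1)
    (hcx : c ≤ x) : hD x c ≤ 2 * (x - c) := by
  have hl : Real.log 2 ≤ 1 := by linarith [Real.log_two_lt_d9]
  rcases eq_or_ne (x - c) 1 with h1 | h1
  · have : x = 1 := le_antisymm hx.2 (by linarith [hc.1])
    have h0 : c = 0 := by linarith
    subst this h0
    rw [hD_one_zero]; linarith
  · have hlt : 0 < 1 - (x - c) := by
      rcases lt_or_gt_of_ne h1 with h | h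
      · linarith
      · linarith [hx.2, hc.1]
    set p := c / (1 - (x - c)) with hp
    have hpc : (1 - (x - c)) * p = c := by rw [hp]; field_simp
    have hp0 : p ∈ Set.Icc (0 : ℝ) 1 := by
      refine ⟨div_nonneg hc.1 hlt.le, ?_⟩
      rw [hp, div_le_one hlt]; linarith [hx.2]
    have h := hD_convex hp0 hp0 (x₁ := 1) (c₁ := 0) (by simp) (by simp) hlt.le
      (sub_nonneg.2 hcx) (by ring)
    rw [hD_one_zero, hD_self, hpc] at h
    rw [show c + (x - c) * 1 = x by ring, show c + (x - c) * 0 = c by ring] at h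
    nlinarith [sub_nonneg.2 hcx]

/-- The constant in the linear lower bound for `hD`. -/
noncomputable def kap : ℝ := Real.log (32 / 27) / 2

theorem kap_pos : 0 < kap := by
  unfold kap
  have := Real.log_pos (x := 32 / 27) (by norm_num)
  positivity

/-- Tangent plane with slope ratio `1 : 1/2` for the errors and `1 : 1`, which contributes zero, for
the complements. The coefficient of `c` is negative, so `c = x / 2` is the worst case and produces
`kap`. -/
theorem kap_mul_le_hD {x c : ℝ} (hx : x ∈ Set.Icc (0 : ℝ) 1) (hc : 0 ≤ c) (hcx : c ≤ x / 2) :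
    kap * x ≤ hD x c := by
  have h1 := logSum_two hx.1 hc (A := 1) (B := 1 / 2) (by norm_num) (by norm_num)
  have h2 := logSum_two (x := 1 - x) (c := 1 - c) (A := 1) (B := 1) (by linarith [hx.2])
    (by linarith [hx.2]) (by norm_num) (by norm_num)
  rw [show (1 - x + (1 - c)) / 2 = 1 - (x + c) / 2 by ring] at h2
  norm_num at h2
  rw [hD_eq_mul_log]
  have hk : kap = (Real.log 1 - Real.log ((1 + 1 / 2) / 2)) +
      (Real.log (1 / 2) - Real.log ((1 + 1 / 2) / 2)) / 2 := by
    rw [kap, show ((1 + 1 / 2) / 2 : ℝ) = 3 / 4 by norm_num,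
      show (32 / 27 : ℝ) = 1 / 2 / (3 / 4) ^ 3 by norm_num,
      Real.log_div (by norm_num) (by norm_num), Real.log_pow, Real.log_one]
    push_cast; ring
  have hneg : Real.log (1 / 2) - Real.log ((1 + 1 / 2) / 2) ≤ 0 := by
    have := Real.log_le_log (x := 1 / 2) (y := (1 + 1 / 2) / 2) (by norm_num) (by norm_num)
    linarith
  rw [hk]
  nlinarith

/-! ### The inverse of `hD` -/

theorem le_hDInv {x y c : ℝ} (hx : x ∈ Set.Icc (0 : ℝ) 1) (h : hD x c ≤ y) : x ≤ hDInv y c :=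
  le_csSup ⟨1, fun _ hz => hz.1.2⟩ ⟨hx, h⟩

theorem min_le_hDInv {y c : ℝ} (hy : 0 ≤ y) (hc : c ∈ Set.Icc (0 : ℝ) 1) :
    min 1 (c + y / 2) ≤ hDInv y c := by
  have hm : min 1 (c + y / 2) ∈ Set.Icc (0 : ℝ) 1 :=
    ⟨le_min zero_le_one (by linarith [hc.1]), min_le_left _ _⟩
  refine le_hDInv hm ((hD_le_two_mul_sub hm hc (le_min hc.2 (by linarith))).trans ?_)
  linarith [min_le_right 1 (c + y / 2)]

/-- Either `A ≤ 2 * L`, or the linear lower bound applies and gives `kap * A ≤ y`. -/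
theorem le_max_of_hD_le {A L y : ℝ} (hA : A ∈ Set.Icc (0 : ℝ) 1) (hL : L ∈ Set.Icc (0 : ℝ) 1)
    (hy : 0 ≤ y) (h : L < A → hD A L ≤ y) : A ≤ 2 * L + y / kap := by
  have hk := kap_pos
  have hyk : 0 ≤ y / kap := by positivity
  by_contra! hlt
  have h1 := kap_mul_le_hD hA hL.1 (by linarith)
  have h2 := h (by linarith [hL.1])
  have : A ≤ y / kap := by rw [le_div_iff₀ hk]; linarith
  linarith [hL.1]

/-- Passage from a bound on `hD` to a bound in terms of its inverse at a shifted point, with the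
constant taken out of the inverse. -/
theorem sub_le_mul_hDInv {A L y e C₀ : ℝ} (hA : A ∈ Set.Icc (0 : ℝ) 1)
    (hL : L ∈ Set.Icc (0 : ℝ) 1) (he : 0 ≤ e) (hey : 72 * e ≤ y) (hC : 1 ≤ C₀)
    (h : L < A → hD A L ≤ C₀ * y) :
    A - L ≤ (4 * C₀ + 4 * (1 + C₀ / kap)) * (hDInv y (max 0 (L - 9 * e)) - L + e) := by
  have hk := kap_pos
  have hy : 0 ≤ y := by linarith
  set c := max 0 (L - 9 * e) with hcdef
  have hcL : c ≤ L := max_le hL.1 (by linarith)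
  have hc : c ∈ Set.Icc (0 : ℝ) 1 := ⟨le_max_left _ _, hcL.trans hL.2⟩
  have hLc : L - 9 * e ≤ c := le_max_right _ _
  have hCk : 0 ≤ C₀ / kap := by positivity
  have hmin := min_le_hDInv hy hc
  rcases min_le_iff.1 hmin with h1 | h1
  · have : A - L ≤ hDInv y c - L + e := by linarith [hA.2]
    have h0 : 0 ≤ hDInv y c - L + e := by linarith [hL.2]
    nlinarith
  -- The shift costs at most `8 * e ≤ y / 9`, out of the `y / 2` available.
  have h0 : y / 4 ≤ hDInv y c - L + e := by linarith
  rcases le_or_gt A L with hAL | hAL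
  · have : 0 ≤ hDInv y c - L + e := by linarith
    have : 0 ≤ (4 * C₀ + 4 * (1 + C₀ / kap)) * (hDInv y c - L + e) := by positivity
    linarith
  -- If `c < L / 2`, then `L < 18 * e ≤ y / 4`, so `L` itself is negligible against `y`.
  rcases lt_or_ge c (L / 2) with hcl | hcl
  · have h2 := le_max_of_hD_le hA hL (y := C₀ * y) (by positivity) h
    rw [mul_div_right_comm] at h2
    have h3 : A - L ≤ (1 + C₀ / kap) * y := by nlinarith
    have h4 : (1 + C₀ / kap) * y ≤ 4 * (1 + C₀ / kap) * (hDInv y c - L + e) := by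
      nlinarith
    have h5 : 0 ≤ 4 * C₀ * (hDInv y c - L + e) := by
      have : 0 ≤ hDInv y c - L + e := by linarith
      positivity
    linarith
  -- Moving only the fraction `C₀⁻¹` of the way from `L` to `A` removes `C₀` by convexity. Scaling
  -- by `c / L ≥ 1 / 2` towards the origin then replaces `L` by `c` and loses at most half of the
  -- gap.
  · have hA' : L + C₀⁻¹ * (A - L) ∈ Set.Icc (0 : ℝ) 1 := by
      have := (convex_Icc (0 : ℝ) 1) hL hA (a := 1 - C₀⁻¹) (b := C₀⁻¹)
        (sub_nonneg.2 (inv_le_one_of_one_le₀ hC)) (by positivity) (by ring)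
      simp only [smul_eq_mul] at this
      rwa [show (1 - C₀⁻¹) * L + C₀⁻¹ * A = L + C₀⁻¹ * (A - L) by ring] at this
    have h2 : hD (L + C₀⁻¹ * (A - L)) L ≤ y := by
      refine (hD_segment_le hA hL (by positivity) (inv_le_one_of_one_le₀ hC)).trans ?_
      rw [inv_mul_le_iff₀ (by linarith)]
      exact h hAL
    have h3 : c + C₀⁻¹ * (A - L) / 2 ≤ hDInv y c := by
      rcases hL.1.eq_or_lt with hL0 | hL0
      · have : c = L := by linarith [hc.1]
        rw [this]
        have := le_hDInv hA' h2
        have h5 : 0 ≤ C₀⁻¹ * (A - L) := mul_nonneg (by positivity) (by linarith)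
        linarith
      · have hs0 : 0 ≤ c / L := div_nonneg hc.1 hL0.le
        have hs1 : c / L ≤ 1 := (div_le_one hL0).2 hcL
        have hs2 : 1 / 2 ≤ c / L := by rw [div_le_div_iff₀ (by norm_num) hL0]; linarith
        have h4 := hD_smul_le hA' hL hs0 hs1
        rw [show c / L * L = c by field_simp] at h4
        have h5 : 0 ≤ C₀⁻¹ * (A - L) := mul_nonneg (by positivity) (by linarith)
        have h6 := le_hDInv (x := c / L * (L + C₀⁻¹ * (A - L))) (y := y) (c := c)
          ⟨mul_nonneg hs0 hA'.1, mul_le_one₀ hs1 hA'.1 hA'.2⟩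
          (h4.trans ((mul_le_of_le_one_left (hD_nonneg hA' hL) hs1).trans h2))
        rw [mul_add, show c / L * L = c by field_simp] at h6
        nlinarith
    -- The loss `8 * e` is absorbed by `h0`, since `18 * e ≤ y / 4`.
    have h4 : C₀⁻¹ * (A - L) / 4 ≤ hDInv y c - L + e := by linarith
    have h5 : A - L ≤ 4 * C₀ * (hDInv y c - L + e) := by
      have := mul_le_mul_of_nonneg_left h4 (by linarith : 0 ≤ 4 * C₀)
      have h7 : 4 * C₀ * (C₀⁻¹ * (A - L) / 4) = A - L := by field_simp
      linarith
    have h6 : 0 ≤ 4 * (1 + C₀ / kap) * (hDInv y c - L + e) := by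
      have : 0 ≤ hDInv y c - L + e := by linarith
      positivity
    linarith

/-! ### Binomial coefficients and entropy -/

theorem exp_mul_binEntropy {n k l : ℕ} (hn : 0 < n) (h : k + l = n) :
    Real.exp (n * Real.binEntropy (k / n)) * ((k : ℝ) ^ k * (l : ℝ) ^ l) = (n : ℝ) ^ n := by
  have hn' : (0 : ℝ) < n := by exact_mod_cast hn
  have key : ∀ m : ℕ, (m : ℝ) ^ m = Real.exp (m * Real.log m) := by
    intro m
    rcases Nat.eq_zero_or_pos m with rfl | hm
    · simp
    · rw [Real.exp_nat_mul, Real.exp_log (by exact_mod_cast hm)]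
  have hsub : 1 - (k : ℝ) / n = l / n := by
    rw [← h]; push_cast
    have : (k : ℝ) + l ≠ 0 := by rw [← Nat.cast_add, h]; exact hn'.ne'
    field_simp; ring
  have hlog : ∀ m : ℕ, (m : ℝ) * Real.log (m / n) = m * Real.log m - m * Real.log n := by
    intro m
    rcases Nat.eq_zero_or_pos m with rfl | hm
    · simp
    · rw [Real.log_div (by positivity) hn'.ne']; ring
  rw [key, key, key, ← Real.exp_add, ← Real.exp_add]
  congr 1
  simp only [Real.binEntropy, Real.log_inv, hsub]
  have h1 := hlog k
  have h2 := hlog l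
  have h3 : (k : ℝ) + l = n := by exact_mod_cast h
  have h4 : (n : ℝ) * ((k : ℝ) / n * -Real.log (k / n) + l / n * -Real.log (l / n)) =
      -(k * Real.log (k / n)) - l * Real.log (l / n) := by field_simp; ring
  rw [h4, h1, h2, ← h3]; ring

theorem pow_self_le_exp_mul_factorial (m : ℕ) : (m : ℝ) ^ m ≤ Real.exp m * m.factorial := by
  have h := Real.pow_div_factorial_le_exp (m : ℝ) (Nat.cast_nonneg m) m
  rwa [div_le_iff₀ (by positivity)] at h

/-- Crude Stirling bound; the induction step is `e ≤ (1 + 1/m) ^ (m + 1)`. Polynomial losses are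
harmless, as they cost only `log n / n` in the end. -/
theorem factorial_mul_exp_le_of_pos {m : ℕ} (hm : 1 ≤ m) :
    (m.factorial : ℝ) * Real.exp m ≤ Real.exp 1 * (m : ℝ) ^ (m + 1) := by
  induction m, hm using Nat.le_induction with
  | base => simp
  | succ m hm ih =>
    have hm' : (0 : ℝ) < m := by exact_mod_cast hm
    have h1 : Real.exp 1 * (m : ℝ) ^ (m + 1) ≤ ((m : ℝ) + 1) ^ (m + 1) := by
      have h2 : (m : ℝ) / (m + 1) ≤ Real.exp (-(1 / (m + 1))) := by
        refine le_trans (le_of_eq ?_) (Real.add_one_le_exp _)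
        field_simp; ring
      have h3 := pow_le_pow_left₀ (by positivity) h2 (m + 1)
      rw [← Real.exp_nat_mul, show ((m + 1 : ℕ) : ℝ) * -(1 / ((m : ℝ) + 1)) = -1 by
        push_cast; field_simp, div_pow, div_le_iff₀ (by positivity), Real.exp_neg] at h3
      have he := Real.exp_pos 1
      calc Real.exp 1 * (m : ℝ) ^ (m + 1) ≤
          Real.exp 1 * ((Real.exp 1)⁻¹ * ((m : ℝ) + 1) ^ (m + 1)) := by gcongr
        _ = _ := by field_simp
    rw [Nat.factorial_succ]
    push_cast
    rw [Real.exp_add]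
    calc ((m : ℝ) + 1) * m.factorial * (Real.exp m * Real.exp 1)
        = ((m : ℝ) + 1) * Real.exp 1 * (m.factorial * Real.exp m) := by ring
      _ ≤ ((m : ℝ) + 1) * Real.exp 1 * (Real.exp 1 * (m : ℝ) ^ (m + 1)) := by gcongr
      _ ≤ ((m : ℝ) + 1) * Real.exp 1 * ((m : ℝ) + 1) ^ (m + 1) := by gcongr
      _ = _ := by ring

theorem factorial_mul_exp_le (m : ℕ) :
    (m.factorial : ℝ) * Real.exp m ≤ Real.exp 1 * (m + 1) * (m : ℝ) ^ m := by
  rcases Nat.eq_zero_or_pos m with rfl | hm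
  · simp
  · refine (factorial_mul_exp_le_of_pos hm).trans ?_
    rw [pow_succ', ← mul_assoc]
    gcongr
    linarith

theorem pow_self_le_choose {k l : ℕ} : ((k + l : ℕ) : ℝ) ^ (k + l) ≤
    Real.exp 1 ^ 2 * ((k + 1) * (l + 1)) * (k + l).choose k * ((k : ℝ) ^ k * (l : ℝ) ^ l) := by
  have h0 := pow_self_le_exp_mul_factorial (k + l)
  have h1 := factorial_mul_exp_le k
  have h2 := factorial_mul_exp_le l
  have h3 : ((k + l).factorial : ℝ) = (k + l).choose k * k.factorial * l.factorial := by
    have := Nat.choose_mul_factorial_mul_factorial (Nat.le_add_right k l)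
    rw [Nat.add_sub_cancel_left] at this
    exact_mod_cast this.symm
  refine h0.trans ?_
  rw [h3]
  push_cast
  rw [Real.exp_add]
  calc Real.exp k * Real.exp l * ((k + l).choose k * k.factorial * l.factorial)
      = (k + l).choose k * ((k.factorial * Real.exp k) * (l.factorial * Real.exp l)) := by ring
    _ ≤ (k + l).choose k * ((Real.exp 1 * (k + 1) * (k : ℝ) ^ k) *
        (Real.exp 1 * (l + 1) * (l : ℝ) ^ l)) := by gcongr
    _ = _ := by ring

/-- The left side is one term of the binomial expansion of `(k + l) ^ (k + l)`. -/
theorem choose_mul_pow_le (k l : ℕ) :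
    ((k + l).choose k : ℝ) * ((k : ℝ) ^ k * (l : ℝ) ^ l) ≤ ((k + l : ℕ) : ℝ) ^ (k + l) := by
  push_cast
  rw [add_pow]
  have := Finset.single_le_sum (f := fun m => (k : ℝ) ^ m * (l : ℝ) ^ (k + l - m) *
    ((k + l).choose m : ℝ)) (s := Finset.range (k + l + 1)) (fun _ _ => by positivity)
    (Finset.mem_range.2 (show k < k + l + 1 by omega))
  refine le_trans (le_of_eq ?_) this
  simp only [Nat.add_sub_cancel_left]
  ring

theorem choose_le_exp_binEntropy {n k : ℕ} (hn : 0 < n) (hk : k ≤ n) :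
    (n.choose k : ℝ) ≤ Real.exp (n * Real.binEntropy (k / n)) := by
  obtain ⟨l, rfl⟩ := Nat.exists_eq_add_of_le hk
  have h1 := exp_mul_binEntropy hn (k := k) (l := l) rfl
  have h2 := choose_mul_pow_le k l
  rw [← h1] at h2
  have hp : ∀ m : ℕ, (0 : ℝ) < (m : ℝ) ^ m := fun m => by exact_mod_cast Nat.pow_self_pos
  exact le_of_mul_le_mul_right h2 (mul_pos (hp k) (hp l))

theorem exp_binEntropy_le_choose {n k : ℕ} (hn : 0 < n) (hk : k ≤ n) :
    Real.exp (n * Real.binEntropy (k / n)) ≤ 8 * (n + 1) ^ 2 * n.choose k := by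
  obtain ⟨l, rfl⟩ := Nat.exists_eq_add_of_le hk
  have h1 := exp_mul_binEntropy hn (k := k) (l := l) rfl
  have h2 := pow_self_le_choose (k := k) (l := l)
  rw [← h1] at h2
  have hp : ∀ m : ℕ, (0 : ℝ) < (m : ℝ) ^ m := fun m => by exact_mod_cast Nat.pow_self_pos
  refine (le_of_mul_le_mul_right h2 (mul_pos (hp k) (hp l))).trans ?_
  have he : Real.exp 1 ^ 2 ≤ 8 := by nlinarith [Real.exp_one_lt_d9, Real.exp_pos 1]
  gcongr
  push_cast
  nlinarith [(Nat.cast_nonneg k : (0 : ℝ) ≤ k), (Nat.cast_nonneg l : (0 : ℝ) ≤ l)]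

/-- The hypergeometric likelihood ratio bound behind `hD`. -/
theorem exp_mul_hD_le {n k l : ℕ} (hn : 0 < n) (hk : k ≤ n) (hl : l ≤ n) :
    Real.exp (n * hD (l / n) (k / n)) ≤
      8 * (2 * n + 1) ^ 2 * (2 * n).choose (k + l) * ((n.choose k : ℝ)⁻¹ * (n.choose l : ℝ)⁻¹) := by
  have hn' : (0 : ℝ) < n := by exact_mod_cast hn
  have h1 := choose_le_exp_binEntropy hn hk
  have h2 := choose_le_exp_binEntropy hn hl
  have h3 := exp_binEntropy_le_choose (n := 2 * n) (k := k + l) (by omega) (by omega)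
  have c1 : (0 : ℝ) < n.choose k := by exact_mod_cast Nat.choose_pos hk
  have c2 : (0 : ℝ) < n.choose l := by exact_mod_cast Nat.choose_pos hl
  have e : (n : ℝ) * hD (l / n) (k / n) = ((2 * n : ℕ) : ℝ) *
      Real.binEntropy (((k + l : ℕ) : ℝ) / (2 * n : ℕ)) - n * Real.binEntropy (k / n) -
      n * Real.binEntropy (l / n) := by
    rw [hD]; push_cast
    rw [show ((l : ℝ) / n + k / n) / 2 = (k + l) / (2 * n) by field_simp; ring]
    ring
  rw [e, Real.exp_sub, Real.exp_sub, div_div, div_eq_mul_inv, ← mul_inv]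
  push_cast at h3 ⊢
  gcongr

/-! ### Averaging over permutations of a double sample -/

section Perm

variable {ι : Type*} [Fintype ι] [DecidableEq ι]

theorem exists_perm_map_eq {s t : Finset ι} (h : s.card = t.card) :
    ∃ σ : Equiv.Perm ι, s.map σ.toEmbedding = t := by
  let e : {x // x ∈ s} ≃ {x // x ∈ t} := Finset.equivOfCardEq h
  refine ⟨e.extendSubtype, Finset.eq_of_subset_of_card_le ?_ (by simp [h])⟩
  intro x hx
  obtain ⟨y, hy, rfl⟩ := Finset.mem_map.1 hx
  exact e.extendSubtype_mem y hy

/-- A uniformly random permutation carries `s` to a uniformly random set of the same size: right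
multiplication makes the sum over `σ` depend on the size alone, and the claim follows by double
counting. -/
theorem choose_mul_sum_perm (G : Finset ι → ℝ) (s : Finset ι) :
    ((Fintype.card ι).choose s.card : ℝ) * ∑ σ : Equiv.Perm ι, G (s.map σ.toEmbedding) =
      (Fintype.card (Equiv.Perm ι)) * ∑ t ∈ Finset.powersetCard s.card Finset.univ, G t := by
  have h1 : ∀ t ∈ Finset.powersetCard s.card (Finset.univ : Finset ι),
      ∑ σ : Equiv.Perm ι, G (t.map σ.toEmbedding) =
        ∑ σ : Equiv.Perm ι, G (s.map σ.toEmbedding) := by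
    intro t ht
    obtain ⟨τ, rfl⟩ := exists_perm_map_eq (s := s) (t := t) (Finset.mem_powersetCard.1 ht).2.symm
    refine Fintype.sum_equiv (Equiv.mulRight τ) _ _ fun σ => ?_
    rw [Finset.map_map]; rfl
  have h2 := Finset.sum_congr rfl h1
  rw [Finset.sum_const, Finset.card_powersetCard, Finset.card_univ, nsmul_eq_mul] at h2
  rw [← h2, Finset.sum_comm]
  have h3 : ∀ σ : Equiv.Perm ι, ∑ t ∈ Finset.powersetCard s.card Finset.univ,
      G (t.map σ.toEmbedding) = ∑ t ∈ Finset.powersetCard s.card Finset.univ, G t := by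
    intro σ
    refine Finset.sum_bij' (fun t _ => t.map σ.toEmbedding) (fun t _ => t.map σ.symm.toEmbedding)
      ?_ ?_ ?_ ?_ ?_
    · intro t ht; simpa [Finset.mem_powersetCard] using ht
    · intro t ht; simpa [Finset.mem_powersetCard] using ht
    · intro t _; ext; simp
    · intro t _; ext; simp
    · intro t _; rfl
  simp [h3]

end Perm

/-- For a fixed left part, the right parts of complementary size have total weight at most `1`. The
left parts of each size also have total weight `1`, and there are `n + 1` sizes. -/
theorem sum_inv_choose_mul_le (n t : ℕ) :
    ∑ s ∈ Finset.powersetCard t (Finset.univ : Finset (Fin n ⊕ Fin n)),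
      ((n.choose s.toLeft.card : ℝ)⁻¹ * (n.choose s.toRight.card : ℝ)⁻¹) ≤ n + 1 := by
  have h0 : ∑ s ∈ Finset.powersetCard t (Finset.univ : Finset (Fin n ⊕ Fin n)),
      ((n.choose s.toLeft.card : ℝ)⁻¹ * (n.choose s.toRight.card : ℝ)⁻¹) =
      ∑ a : Finset (Fin n), ∑ b : Finset (Fin n), if a.card + b.card = t then
        ((n.choose a.card : ℝ)⁻¹ * (n.choose b.card : ℝ)⁻¹) else 0 := by
    rw [← Fintype.sum_prod_type', Finset.powersetCard_eq_filter, Finset.sum_filter,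
      Finset.powerset_univ]
    refine Fintype.sum_equiv Finset.sumEquiv.toEquiv _ _ fun s => ?_
    simp [Finset.sumEquiv, Finset.card_toLeft_add_card_toRight]
  have h1 : ∀ a : Finset (Fin n), (∑ b : Finset (Fin n), if a.card + b.card = t then
        ((n.choose a.card : ℝ)⁻¹ * (n.choose b.card : ℝ)⁻¹) else 0) ≤
        (n.choose a.card : ℝ)⁻¹ := by
    intro a
    have := Finset.sum_powerset_apply_card (fun m => if a.card + m = t then
      ((n.choose a.card : ℝ)⁻¹ * (n.choose m : ℝ)⁻¹) else 0) (x := (Finset.univ : Finset (Fin n)))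
    rw [Finset.powerset_univ] at this
    rw [this, Finset.card_univ, Fintype.card_fin]
    calc ∑ m ∈ Finset.range (n + 1), n.choose m • (if a.card + m = t then
          ((n.choose a.card : ℝ)⁻¹ * (n.choose m : ℝ)⁻¹) else 0)
        -- If `a.card > t` the subtraction truncates, which is harmless because only an upper bound
        -- is needed.
        ≤ ∑ m ∈ Finset.range (n + 1), if m = t - a.card then (n.choose a.card : ℝ)⁻¹ else 0 := by
          refine Finset.sum_le_sum fun m hm => ?_
          have hc : (n.choose m : ℝ) ≠ 0 := by
            exact_mod_cast (Nat.choose_pos (Nat.lt_succ_iff.1 (Finset.mem_range.1 hm))).ne'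
          split_ifs with h h' h'
          · rw [nsmul_eq_mul]; field_simp; exact le_rfl
          · omega
          · simp
          · simp
      _ ≤ _ := by
          rw [Finset.sum_ite_eq']
          split_ifs
          · exact le_rfl
          · positivity
  rw [h0]
  refine (Finset.sum_le_sum fun a _ => h1 a).trans ?_
  have := Finset.sum_powerset_apply_card (fun m => (n.choose m : ℝ)⁻¹)
    (x := (Finset.univ : Finset (Fin n)))
  rw [Finset.powerset_univ] at this
  rw [this, Finset.card_univ, Fintype.card_fin]
  refine (Finset.sum_le_card_nsmul _ _ 1 fun m hm => ?_).trans (by simp)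
  have hc : (n.choose m : ℝ) ≠ 0 := by
    exact_mod_cast (Nat.choose_pos (Nat.lt_succ_iff.1 (Finset.mem_range.1 hm))).ne'
  rw [nsmul_eq_mul, mul_inv_cancel₀ hc]

/-- `exp (n h_D)` of the error frequencies on the second and on the first half of a sample whose
errors sit at the positions in `s`. -/
noncomputable def expHD (n : ℕ) (s : Finset (Fin n ⊕ Fin n)) : ℝ :=
  Real.exp (n * hD (s.toRight.card / n) (s.toLeft.card / n))

/-- The polynomial factor of the symmetrization bound. -/
noncomputable def polyFactor (n : ℕ) : ℝ := 8 * (2 * n + 1) ^ 2 * (n + 1)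

/-- The factor `(2 * n).choose s.card` from the likelihood ratio cancels the number of sets over
which `choose_mul_sum_perm` averages. -/
theorem sum_perm_expHD_le {n : ℕ} (hn : 0 < n) (s : Finset (Fin n ⊕ Fin n)) :
    ∑ σ : Equiv.Perm (Fin n ⊕ Fin n), expHD n (s.map σ.toEmbedding) ≤
      Fintype.card (Equiv.Perm (Fin n ⊕ Fin n)) * polyFactor n := by
  have hcard : Fintype.card (Fin n ⊕ Fin n) = 2 * n := by simp; ring
  have h1 := choose_mul_sum_perm (expHD n) s
  rw [hcard] at h1
  have hs : s.card ≤ 2 * n := by rw [← hcard]; exact Finset.card_le_univ s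
  have hc : (0 : ℝ) < (2 * n).choose s.card := by exact_mod_cast Nat.choose_pos hs
  refine le_of_mul_le_mul_left ?_ hc
  rw [h1, mul_left_comm]
  gcongr
  calc ∑ t ∈ Finset.powersetCard s.card Finset.univ, expHD n t
      ≤ ∑ t ∈ Finset.powersetCard s.card (Finset.univ : Finset (Fin n ⊕ Fin n)),
        8 * (2 * n + 1) ^ 2 * (2 * n).choose s.card *
          ((n.choose t.toLeft.card : ℝ)⁻¹ * (n.choose t.toRight.card : ℝ)⁻¹) := by
        refine Finset.sum_le_sum fun t ht => ?_
        have := exp_mul_hD_le hn (k := t.toLeft.card) (l := t.toRight.card)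
          (by simpa using Finset.card_le_univ t.toLeft)
          (by simpa using Finset.card_le_univ t.toRight)
        rwa [Finset.card_toLeft_add_card_toRight, (Finset.mem_powersetCard.1 ht).2] at this
    _ ≤ 8 * (2 * n + 1) ^ 2 * (2 * n).choose s.card * (n + 1) := by
        rw [← Finset.mul_sum]
        gcongr
        exact sum_inv_choose_mul_le n s.card
    _ = _ := by rw [polyFactor]; ring

/-! ### Symmetrization -/

theorem measurable_comp_finset {Ω ι β : Type*} [MeasurableSpace Ω] [MeasurableSpace β] [Fintype ι]
    {B : Ω → Finset ι} (hB : ∀ i, MeasurableSet {ω | i ∈ B ω}) (g : Finset ι → β) :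
    Measurable fun ω => g (B ω) := by
  let _ : MeasurableSpace (Finset ι) := ⊤
  have h : Measurable B := by
    refine measurable_to_countable' fun s => ?_
    have : B ⁻¹' {s} = ⋂ i, {ω | i ∈ B ω ↔ i ∈ s} := by
      ext ω; simp [Finset.ext_iff]
    rw [this]
    refine MeasurableSet.iInter fun i => ?_
    by_cases hi : i ∈ s
    · simpa only [hi, iff_true] using hB i
    · simp only [hi, iff_false]
      exact (hB i).compl
  exact (measurable_from_top (f := g)).comp h

section Symmetrization

variable {E C : Type*} [Fintype C] {n : ℕ}

/-- Permuting the sample only relabels the codes and moves each hit set by `σ⁻¹`. Hence the bound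
for a fixed set applies to each code separately. -/
theorem sum_perm_sum_expHD_le (hn : 0 < n) {B : C → (Fin n ⊕ Fin n → E) → Finset (Fin n ⊕ Fin n)}
    (hE : ∀ σ : Equiv.Perm (Fin n ⊕ Fin n), ∃ e : Equiv.Perm C, ∀ c Z i,
      i ∈ B c (Z ∘ σ) ↔ σ i ∈ B (e c) Z) (Z : Fin n ⊕ Fin n → E) :
    ∑ σ : Equiv.Perm (Fin n ⊕ Fin n), ∑ c, expHD n (B c (Z ∘ σ)) ≤
      Fintype.card (Equiv.Perm (Fin n ⊕ Fin n)) * (Fintype.card C * polyFactor n) := by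
  have h1 : ∀ σ : Equiv.Perm (Fin n ⊕ Fin n), ∑ c, expHD n (B c (Z ∘ σ)) =
      ∑ c, expHD n ((B c Z).map (σ⁻¹).toEmbedding) := by
    intro σ
    obtain ⟨e, he⟩ := hE σ
    refine Fintype.sum_equiv e _ _ fun c => ?_
    congr 1
    ext i
    rw [he, Finset.mem_map_equiv]
    rfl
  rw [Finset.sum_congr rfl fun σ _ => h1 σ, Finset.sum_comm]
  calc ∑ c, ∑ σ : Equiv.Perm (Fin n ⊕ Fin n), expHD n ((B c Z).map (σ⁻¹).toEmbedding)
      = ∑ c, ∑ σ : Equiv.Perm (Fin n ⊕ Fin n), expHD n ((B c Z).map σ.toEmbedding) :=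
        Finset.sum_congr rfl fun c _ => Fintype.sum_equiv (Equiv.inv _) _ _ fun σ => rfl
    _ ≤ ∑ _c : C, Fintype.card (Equiv.Perm (Fin n ⊕ Fin n)) * polyFactor n :=
        Finset.sum_le_sum fun c _ => sum_perm_expHD_le hn _
    _ = _ := by rw [Finset.sum_const, Finset.card_univ, nsmul_eq_mul]; ring

/-- Exponential moment bound by symmetrization over all permutations of a double sample, for a
finite class whose members may depend on the double sample in a permutation equivariant way. -/
theorem lintegral_sum_expHD_le [MeasurableSpace E] (hn : 0 < n) (μ : Measure E) [IsProbabilityMeasure μ]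
    {B : C → (Fin n ⊕ Fin n → E) → Finset (Fin n ⊕ Fin n)}
    (hB : ∀ c i, MeasurableSet {Z | i ∈ B c Z})
    (hE : ∀ σ : Equiv.Perm (Fin n ⊕ Fin n), ∃ e : Equiv.Perm C, ∀ c Z i,
      i ∈ B c (Z ∘ σ) ↔ σ i ∈ B (e c) Z) :
    ∫⁻ s, ∫⁻ s', ENNReal.ofReal (∑ c, expHD n (B c (Sum.elim s s')))
      ∂(Measure.pi fun _ : Fin n => μ) ∂(Measure.pi fun _ : Fin n => μ) ≤
      ENNReal.ofReal (Fintype.card C * polyFactor n) := by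
  set Ψ : (Fin n ⊕ Fin n → E) → ENNReal := fun Z => ENNReal.ofReal (∑ c, expHD n (B c Z)) with hΨ
  have hΨm : Measurable Ψ :=
    (Finset.measurable_sum _ fun c _ => measurable_comp_finset (hB c) (expHD n)).ennreal_ofReal
  have h1 : ∫⁻ s, ∫⁻ s', Ψ (Sum.elim s s') ∂(Measure.pi fun _ : Fin n => μ)
      ∂(Measure.pi fun _ : Fin n => μ) = ∫⁻ Z, Ψ Z ∂(Measure.pi fun _ : Fin n ⊕ Fin n => μ) := by
    have hmp := measurePreserving_sumPiEquivProdPi_symm (fun _ : Fin n ⊕ Fin n => μ)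
    refine Eq.trans ?_ ((lintegral_prod (μ := Measure.pi fun _ : Fin n => μ)
      (ν := Measure.pi fun _ : Fin n => μ) _ (hΨm.comp hmp.measurable).aemeasurable).symm.trans
      (hmp.lintegral_comp hΨm))
    refine lintegral_congr fun s => lintegral_congr fun s' => ?_
    congr 1
  have h2 : ∀ σ : Equiv.Perm (Fin n ⊕ Fin n),
      ∫⁻ Z, Ψ (Z ∘ σ) ∂(Measure.pi fun _ : Fin n ⊕ Fin n => μ) =
        ∫⁻ Z, Ψ Z ∂(Measure.pi fun _ : Fin n ⊕ Fin n => μ) := by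
    intro σ
    have hmp := measurePreserving_arrowCongr' (fun _ : Fin n ⊕ Fin n => μ) (fun _ => μ) σ.symm
      (MeasurableEquiv.refl E) (fun _ => MeasurePreserving.id μ)
    rw [← hmp.lintegral_comp hΨm]
    rfl
  have hm : ∀ σ : Equiv.Perm (Fin n ⊕ Fin n), Measurable fun Z : Fin n ⊕ Fin n → E => Ψ (Z ∘ σ) :=
    fun σ => hΨm.comp (measurable_pi_lambda _ fun i => measurable_pi_apply _)
  set N := Fintype.card (Equiv.Perm (Fin n ⊕ Fin n)) with hN
  have hN0 : (N : ENNReal) ≠ 0 := by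
    simp [hN]
  have h3 : (N : ENNReal) * ∫⁻ Z, Ψ Z ∂(Measure.pi fun _ : Fin n ⊕ Fin n => μ) ≤
      N * ENNReal.ofReal (Fintype.card C * polyFactor n) := by
    calc (N : ENNReal) * ∫⁻ Z, Ψ Z ∂(Measure.pi fun _ : Fin n ⊕ Fin n => μ)
        = ∑ σ : Equiv.Perm (Fin n ⊕ Fin n),
            ∫⁻ Z, Ψ (Z ∘ σ) ∂(Measure.pi fun _ : Fin n ⊕ Fin n => μ) := by
          rw [Finset.sum_congr rfl fun σ _ => h2 σ, Finset.sum_const, Finset.card_univ,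
            nsmul_eq_mul]
      _ = ∫⁻ Z, ∑ σ : Equiv.Perm (Fin n ⊕ Fin n), Ψ (Z ∘ σ)
            ∂(Measure.pi fun _ : Fin n ⊕ Fin n => μ) :=
          (lintegral_finsetSum _ fun σ _ => hm σ).symm
      _ ≤ ∫⁻ _Z, N * ENNReal.ofReal (Fintype.card C * polyFactor n)
            ∂(Measure.pi fun _ : Fin n ⊕ Fin n => μ) := by
          refine lintegral_mono fun Z => ?_
          have := sum_perm_sum_expHD_le hn hE Z
          simp only [hΨ]
          rw [← ENNReal.ofReal_sum_of_nonneg fun σ _ =>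
            Finset.sum_nonneg fun c _ => (by unfold expHD; positivity), ← ENNReal.ofReal_natCast, ← ENNReal.ofReal_mul (Nat.cast_nonneg _)]
          exact ENNReal.ofReal_le_ofReal this
      _ = _ := by simp
  rw [h1]
  exact (ENNReal.mul_le_mul_iff_right hN0 (ENNReal.natCast_ne_top _)).1 h3

end Symmetrization

/-! ### Compression of linear classifiers -/

/-- Perceptron sparsification: on finitely many points of a ball, a linear functional is uniformly
close to a short signed sum of these points. -/
theorem exists_sparse_approx {E ι : Type*} [NormedAddCommGroup E] [InnerProductSpace ℝ E]
    [Nonempty ι] (x : ι → E) {ρ τ : ℝ} (hρ : 0 < ρ) (hτ : 0 < τ) (hx : ∀ i, ‖x i‖ ≤ ρ) (T : ℕ) :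
    ∀ w : E, ‖w‖ ^ 2 ≤ (T + 1) * (τ / ρ) ^ 2 → ∃ c : Fin T → ι × SignType, ∀ i,
      |⟪x i, w - (τ / ρ ^ 2) • ∑ t, ((c t).2 : ℝ) • x (c t).1⟫_ℝ| ≤ τ := by
  induction T with
  | zero =>
    intro w hw
    refine ⟨Fin.elim0, fun i => ?_⟩
    have hw' : ‖w‖ ≤ τ / ρ := by
      refine le_of_sq_le_sq ?_ (by positivity)
      simpa using hw
    simp only [Finset.univ_eq_empty, Finset.sum_empty, smul_zero, sub_zero]
    calc |⟪x i, w⟫_ℝ| ≤ ‖x i‖ * ‖w‖ := abs_real_inner_le_norm _ _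
      _ ≤ ρ * (τ / ρ) := by gcongr; exact hx i
      _ = τ := by field_simp
  | succ T ih =>
    intro w hw
    by_cases hall : ∀ i, |⟪x i, w⟫_ℝ| ≤ τ
    · refine ⟨fun _ => (Classical.arbitrary ι, 0), fun i => ?_⟩
      simpa using hall i
    · push Not at hall
      obtain ⟨j, hj⟩ := hall
      set a := ⟪x j, w⟫_ℝ with ha
      set s : ℝ := ((SignType.sign a : SignType) : ℝ) with hs
      have hsa : s * a = |a| := by rw [hs]; exact sign_mul_self a
      have hs2 : s ^ 2 ≤ 1 := by
        rw [hs]; cases SignType.sign a <;> simp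
      -- Subtracting a point with score above `τ` lowers the squared norm by at least `2 (τ/ρ)² -
      -- (τ/ρ)²`, which pays for one of the `T + 1` units.
      have hnorm : ‖w - (τ / ρ ^ 2) • (s • x j)‖ ^ 2 ≤ (T + 1) * (τ / ρ) ^ 2 := by
        rw [norm_sub_sq_real, inner_smul_right, inner_smul_right, real_inner_comm, ← ha, hsa,
          norm_smul, norm_smul, mul_pow, mul_pow, Real.norm_eq_abs, Real.norm_eq_abs, sq_abs,
          sq_abs]
        have h1 : (τ / ρ ^ 2) ^ 2 * (s ^ 2 * ‖x j‖ ^ 2) ≤ (τ / ρ ^ 2) ^ 2 * (1 * ρ ^ 2) := by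
          gcongr; exact hx j
        have h2 : (τ / ρ ^ 2) ^ 2 * (1 * ρ ^ 2) = (τ / ρ) ^ 2 := by field_simp
        have h3 : τ / ρ ^ 2 * τ ≤ τ / ρ ^ 2 * |a| := by gcongr
        have h4 : τ / ρ ^ 2 * τ = (τ / ρ) ^ 2 := by field_simp
        push_cast at hw
        nlinarith
      obtain ⟨c, hc⟩ := ih _ hnorm
      refine ⟨Fin.cons (j, SignType.sign a) c, fun i => ?_⟩
      have := hc i
      rw [Fin.sum_univ_succ]
      simp only [Fin.cons_zero, Fin.cons_succ, smul_add]
      rwa [← sub_sub]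

/-- Codes of the compressed classifiers: a signed sequence of sample points and a grid point. -/
abbrev Code (n T L : ℕ) : Type := (Fin T → (Fin n ⊕ Fin n) × SignType) × Fin L

theorem card_code (n T L : ℕ) : Fintype.card (Code n T L) = (6 * n) ^ T * L := by
  have : Fintype.card SignType = 3 := rfl
  simp [this]
  left; congr 1; ring

section Decode

variable {d n T L : ℕ}

/-- The signed margin, at the point `Z i` of a double sample, of the predictor encoded by `c`. -/
noncomputable def score (b u : Feat d) (κ η δ : ℝ) (c : Code n T L) (Z : Fin n ⊕ Fin n → Sample d)
    (i : Fin n ⊕ Fin n) : ℝ :=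
  ((Z i).2 : ℝ) * (⟪(Z i).1, u⟫_ℝ + κ * (⟪(Z i).1 - b,
    η • ∑ t, ((c.1 t).2 : ℝ) • ((Z (c.1 t).1).1 - b)⟫_ℝ + ((c.2 : ℝ) * δ - ‖b‖)))

/-- The positions of a double sample where the encoded predictor has margin below `θ`. -/
noncomputable def hits (b u : Feat d) (κ η δ θ : ℝ) (c : Code n T L)
    (Z : Fin n ⊕ Fin n → Sample d) : Finset (Fin n ⊕ Fin n) :=
  open scoped Classical in Finset.univ.filter fun i => score b u κ η δ c Z i < θ

theorem mem_hits {b u : Feat d} {κ η δ θ : ℝ} {c : Code n T L} {Z : Fin n ⊕ Fin n → Sample d}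
    {i : Fin n ⊕ Fin n} : i ∈ hits b u κ η δ θ c Z ↔ score b u κ η δ c Z i < θ := by
  simp [hits]

/-- A code names positions in the double sample rather than points, so a permutation acts on codes
by renaming positions. -/
theorem hits_equivariant (b u : Feat d) (κ η δ θ : ℝ) (σ : Equiv.Perm (Fin n ⊕ Fin n)) :
    ∃ e : Equiv.Perm (Code n T L), ∀ c Z i,
      i ∈ hits b u κ η δ θ c (Z ∘ σ) ↔ σ i ∈ hits b u κ η δ θ (e c) Z :=
  ⟨((Equiv.refl (Fin T)).arrowCongr (σ.prodCongr (Equiv.refl SignType))).prodCongr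
    (Equiv.refl (Fin L)), fun c Z i => by rw [mem_hits, mem_hits]; rfl⟩

theorem continuous_score (κ η δ : ℝ) (b : Feat d) (c : Code n T L) (i : Fin n ⊕ Fin n) :
    Continuous fun p : Feat d × (Fin n ⊕ Fin n → Sample d) => score b p.1 κ η δ c p.2 i := by
  unfold score
  fun_prop

theorem exists_grid {v R δ : ℝ} (hδ : 0 < δ) (hv : |v| ≤ R) :
    ∃ j : Fin (⌊2 * R / δ⌋₊ + 1), |v - ((j : ℕ) * δ - R)| ≤ δ := by
  have hv' := abs_le.1 hv
  have h0 : 0 ≤ (v + R) / δ := div_nonneg (by linarith) hδ.le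
  refine ⟨⟨⌊(v + R) / δ⌋₊, Nat.lt_succ_of_le (Nat.floor_mono ?_)⟩, ?_⟩
  · gcongr; linarith
  · have h1 := Nat.floor_le h0
    have h2 := Nat.lt_floor_add_one ((v + R) / δ)
    rw [le_div_iff₀ hδ] at h1
    rw [div_lt_iff₀ hδ] at h2
    rw [abs_le]; constructor <;> simp only <;> linarith

theorem abs_label (y : Label) : |(y : ℝ)| = 1 := by
  obtain ⟨y, hy⟩ := y
  rcases hy with rfl | rfl <;> simp

/-- Every classifier in the unit ball, scaled by `1 / K` and shifted by `u`, is sandwiched on a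
double sample between the margins of an encoded predictor. -/
theorem exists_code [NeZero n] {K : ℕ} (hK : 0 < K) {θ ρ : ℝ} (hθ : 0 < θ) (hρ : 0 < ρ)
    (b u w : Feat d) (hw : ‖w‖ ≤ 1) (Z : Fin n ⊕ Fin n → Sample d)
    (hZ : ∀ i, ‖(Z i).1 - b‖ ≤ ρ) :
    ∃ c : Code n ⌊(ρ / (K * θ / 4)) ^ 2⌋₊ (⌊2 * ‖b‖ / (K * θ / 4)⌋₊ + 1), ∀ i,
      |score b u (1 / K) (K * θ / 4 / ρ ^ 2) (K * θ / 4) c Z i -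
        ((Z i).2 : ℝ) * ⟪(Z i).1, u + (1 / (K : ℝ)) • w⟫_ℝ| ≤ θ / 2 := by
  have hK' : (0 : ℝ) < K := by exact_mod_cast hK
  -- The sparse approximation and the grid each err by at most `τ`; after division by `K` the total
  -- is `θ / 2`.
  set τ := K * θ / 4 with hτ
  have hτ0 : 0 < τ := by positivity
  obtain ⟨c₁, hc₁⟩ := exists_sparse_approx (fun i => (Z i).1 - b) hρ hτ0 hZ ⌊(ρ / τ) ^ 2⌋₊ w (by
    have h1 := Nat.lt_floor_add_one ((ρ / τ) ^ 2)
    have h2 : 1 ≤ (⌊(ρ / τ) ^ 2⌋₊ + 1) * (τ / ρ) ^ 2 := by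
      calc (1 : ℝ) = (ρ / τ) ^ 2 * (τ / ρ) ^ 2 := by field_simp
        _ ≤ _ := by gcongr
    have h3 : ‖w‖ ^ 2 ≤ 1 := pow_le_one₀ (norm_nonneg _) hw
    linarith)
  obtain ⟨j, hj⟩ := exists_grid (v := ⟪b, w⟫_ℝ) (R := ‖b‖) hτ0
    ((abs_real_inner_le_norm b w).trans (mul_le_of_le_one_right (norm_nonneg _) hw))
  refine ⟨(c₁, j), fun i => ?_⟩
  have h1 := hc₁ i
  rw [inner_sub_right] at h1
  simp only [score]
  set p := ⟪(Z i).1 - b, (τ / ρ ^ 2) • ∑ t, ((c₁ t).2 : ℝ) • ((Z (c₁ t).1).1 - b)⟫_ℝ with hp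
  rw [inner_add_right, inner_smul_right]
  have h2 : ⟪(Z i).1, w⟫_ℝ = ⟪(Z i).1 - b, w⟫_ℝ + ⟪b, w⟫_ℝ := by rw [inner_sub_left]; ring
  rw [h2, ← mul_sub, abs_mul, abs_label, one_mul]
  rw [show ⟪(Z i).1, u⟫_ℝ + 1 / (K : ℝ) * (p + ((j : ℕ) * τ - ‖b‖)) -
    (⟪(Z i).1, u⟫_ℝ + 1 / (K : ℝ) * (⟪(Z i).1 - b, w⟫_ℝ + ⟪b, w⟫_ℝ)) =
    -(1 / (K : ℝ) * ((⟪(Z i).1 - b, w⟫_ℝ - p) + (⟪b, w⟫_ℝ - ((j : ℕ) * τ - ‖b‖)))) by ring]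
  rw [abs_neg, abs_mul, abs_of_pos (by positivity : 0 < 1 / (K : ℝ))]
  calc 1 / (K : ℝ) * |(⟪(Z i).1 - b, w⟫_ℝ - p) + (⟪b, w⟫_ℝ - ((j : ℕ) * τ - ‖b‖))|
      ≤ 1 / (K : ℝ) * (τ + τ) := by
        gcongr
        exact (abs_add_le _ _).trans (add_le_add h1 hj)
    _ = θ / 2 := by rw [hτ]; field_simp; ring

theorem empRisk_le {θ : ℝ} {v : Feat d} {s' : Fin n → Sample d}
    {S : Finset (Fin n ⊕ Fin n)} (hS : ∀ i, ((s' i).2 : ℝ) * ⟪(s' i).1, v⟫_ℝ < θ → Sum.inr i ∈ S) :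
    empRisk θ s' v ≤ S.toRight.card / n := by
  classical
  rw [empRisk, one_div, inv_mul_eq_div]
  gcongr
  simp only [marginLoss]
  rw [Finset.sum_boole]
  gcongr
  intro i hi
  simpa using hS i (Finset.mem_filter.1 hi).2

theorem le_empRisk {θ : ℝ} {v : Feat d} {s : Fin n → Sample d}
    {S : Finset (Fin n ⊕ Fin n)} (hS : ∀ i, Sum.inl i ∈ S → ((s i).2 : ℝ) * ⟪(s i).1, v⟫_ℝ < θ) :
    S.toLeft.card / n ≤ empRisk θ s v := by
  classical
  rw [empRisk, one_div, inv_mul_eq_div]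
  gcongr
  simp only [marginLoss]
  rw [Finset.sum_boole]
  gcongr
  intro i hi
  simpa using hS i (Finset.mem_toLeft.1 hi)

/-- The sum of the exponential deviations of all encoded predictors. -/
noncomputable def sumExpHD (K : ℕ) (θ ρ : ℝ) (b u : Feat d) (s s' : Fin n → Sample d) : ℝ :=
  ∑ c : Code n ⌊(ρ / (K * θ / 4)) ^ 2⌋₊ (⌊2 * ‖b‖ / (K * θ / 4)⌋₊ + 1),
    expHD n (hits b u (1 / K) (K * θ / 4 / ρ ^ 2) (K * θ / 4) (θ / 2) c (Sum.elim s s'))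

/-- With threshold `θ / 2` and error `θ / 2`, errors at margin zero on `s'` are hits, and hits on
`s` are errors at margin `θ`. The signs of `p` and `q` fit these two inclusions. The right side is
free of `w`, so `w` may depend on `s`. -/
theorem exp_affine_le_sumExpHD (hn : 0 < n) {K : ℕ} (hK : 0 < K) {θ ρ : ℝ} (hθ : 0 < θ)
    (hρ : 0 < ρ) (b u w : Feat d) (hw : ‖w‖ ≤ 1) (s s' : Fin n → Sample d)
    (hs : ∀ i, ‖(s i).1 - b‖ ≤ ρ) (hs' : ∀ i, ‖(s' i).1 - b‖ ≤ ρ) {p q t : ℝ} (hp : 0 ≤ p)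
    (hq : q ≤ 0) (hpq : ∀ x ∈ Set.Icc (0 : ℝ) 1, ∀ c ∈ Set.Icc (0 : ℝ) 1,
      p * x + q * c + t ≤ hD x c) :
    Real.exp (n * (p * empRisk 0 s' (u + (1 / (K : ℝ)) • w) +
      q * empRisk θ s (u + (1 / (K : ℝ)) • w) + t)) ≤ sumExpHD K θ ρ b u s s' := by
  have : NeZero n := ⟨hn.ne'⟩
  have hn' : (0 : ℝ) < n := by exact_mod_cast hn
  obtain ⟨c, hc⟩ := exists_code hK hθ hρ b u w hw (Sum.elim s s')
    (by rintro (i | i) <;> simp [hs, hs'])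
  set S := hits b u (1 / K) (K * θ / 4 / ρ ^ 2) (K * θ / 4) (θ / 2) c (Sum.elim s s') with hS
  have h1 : empRisk 0 s' (u + (1 / (K : ℝ)) • w) ≤ S.toRight.card / n := by
    refine empRisk_le fun i hi => ?_
    rw [hS, mem_hits]
    have := abs_le.1 (hc (Sum.inr i))
    simp only [Sum.elim_inr] at this
    linarith
  have h2 : S.toLeft.card / n ≤ empRisk θ s (u + (1 / (K : ℝ)) • w) := by
    refine le_empRisk fun i hi => ?_
    rw [hS, mem_hits] at hi
    have := abs_le.1 (hc (Sum.inl i))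
    simp only [Sum.elim_inl] at this
    linarith
  have hIcc : ∀ F : Finset (Fin n), (F.card : ℝ) / n ∈ Set.Icc (0 : ℝ) 1 := fun F =>
    ⟨by positivity, (div_le_one hn').2 (by exact_mod_cast (by simpa using Finset.card_le_univ F))⟩
  refine le_trans ?_ (Finset.single_le_sum (f := fun c => expHD n (hits b u (1 / K)
    (K * θ / 4 / ρ ^ 2) (K * θ / 4) (θ / 2) c (Sum.elim s s')))
    (fun _ _ => (Real.exp_pos _).le) (Finset.mem_univ c))
  refine Real.exp_le_exp.2 (mul_le_mul_of_nonneg_left ?_ hn'.le)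
  refine le_trans ?_ (hpq _ (hIcc _) _ (hIcc _))
  have h3 := mul_le_mul_of_nonneg_left h1 hp
  have h4 := mul_le_mul_of_nonpos_left h2 hq
  linarith

theorem measurable_sumExpHD (K : ℕ) (θ ρ : ℝ) (b : Feat d) :
    Measurable fun p : Feat d × (Fin n → Sample d) × (Fin n → Sample d) =>
      sumExpHD K θ ρ b p.1 p.2.1 p.2.2 := by
  unfold sumExpHD
  refine Finset.measurable_sum _ fun c _ => measurable_comp_finset (fun i => ?_) (expHD n)
  simp only [mem_hits]
  have hm : Measurable fun p : Feat d × (Fin n → Sample d) × (Fin n → Sample d) =>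
      (p.1, (Sum.elim p.2.1 p.2.2 : Fin n ⊕ Fin n → Sample d)) := by
    refine measurable_fst.prodMk (measurable_pi_lambda _ fun i => ?_)
    cases i <;> simp only [Sum.elim_inl, Sum.elim_inr] <;> fun_prop
  exact measurableSet_lt ((continuous_score _ _ _ b c i).measurable.comp hm) measurable_const

/-- The factor in the exponential moment bound. -/
noncomputable def momentBound (n K : ℕ) (θ ρ β : ℝ) : ℝ :=
  ((6 * n : ℝ) ^ ⌊(ρ / (K * θ / 4)) ^ 2⌋₊ * (⌊2 * β / (K * θ / 4)⌋₊ + 1)) * polyFactor n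

theorem lintegral_sumExpHD_le (hn : 0 < n) (K : ℕ) (θ ρ : ℝ) (b u : Feat d)
    (μ : Measure (Sample d)) [IsProbabilityMeasure μ] :
    ∫⁻ s, ∫⁻ s', ENNReal.ofReal (sumExpHD K θ ρ b u s s')
      ∂(Measure.pi fun _ : Fin n => μ) ∂(Measure.pi fun _ : Fin n => μ) ≤
      ENNReal.ofReal (momentBound n K θ ρ ‖b‖) := by
  refine (lintegral_sum_expHD_le hn μ (fun c i => ?_) (hits_equivariant b u _ _ _ _)).trans
    (le_of_eq ?_)
  · simp only [mem_hits]
    exact measurableSet_lt ((continuous_score _ _ _ b c i).measurable.comp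
      (measurable_const.prodMk measurable_id)) measurable_const
  · rw [card_code, momentBound]
    push_cast
    rfl

end Decode

/-! ### Measurability and expectation of the risks -/

section Risk

variable {d n : ℕ}

theorem marginLoss_mem_Icc (θ : ℝ) (z : Sample d) (w : Feat d) :
    marginLoss θ z w ∈ Set.Icc (0 : ℝ) 1 := by
  unfold marginLoss; split_ifs <;> simp

theorem measurable_marginLoss (θ : ℝ) :
    Measurable fun p : Sample d × Feat d => marginLoss θ p.1 p.2 := by
  classical
  unfold marginLoss
  refine Measurable.ite (measurableSet_lt ?_ measurable_const) measurable_const measurable_const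
  exact Continuous.measurable (by fun_prop)

theorem measurable_empRisk (θ : ℝ) :
    Measurable fun p : (Fin n → Sample d) × Feat d => empRisk θ p.1 p.2 := by
  unfold empRisk
  refine (Finset.measurable_sum _ fun i _ => ?_).const_mul _
  exact (measurable_marginLoss θ).comp
    (f := fun p : (Fin n → Sample d) × Feat d => (p.1 i, p.2)) (by fun_prop)

theorem empRisk_mem_Icc (hn : 0 < n) (θ : ℝ) (s : Fin n → Sample d) (w : Feat d) :
    empRisk θ s w ∈ Set.Icc (0 : ℝ) 1 := by
  have hn' : (0 : ℝ) < n := by exact_mod_cast hn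
  unfold empRisk
  refine ⟨mul_nonneg (by positivity) (Finset.sum_nonneg fun i _ => (marginLoss_mem_Icc θ _ _).1), ?_⟩
  rw [one_div, inv_mul_le_iff₀ hn', mul_one]
  exact (Finset.sum_le_card_nsmul _ _ 1 fun i _ => (marginLoss_mem_Icc θ _ _).2).trans (by simp)

theorem integrable_marginLoss (θ : ℝ) (μ : Measure (Sample d)) [IsProbabilityMeasure μ]
    (w : Feat d) : Integrable (fun z => marginLoss θ z w) μ :=
  Integrable.of_mem_Icc 0 1 ((measurable_marginLoss θ).comp
    (f := fun z => (z, w)) (by fun_prop)).aemeasurable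
    (Filter.Eventually.of_forall fun z => marginLoss_mem_Icc θ z w)

theorem popRisk_mem_Icc (μ : Measure (Sample d)) [IsProbabilityMeasure μ] (w : Feat d) :
    popRisk μ w ∈ Set.Icc (0 : ℝ) 1 := by
  unfold popRisk
  refine ⟨integral_nonneg fun z => (marginLoss_mem_Icc 0 z w).1, ?_⟩
  refine (integral_mono (integrable_marginLoss 0 μ w) (integrable_const 1)
    fun z => (marginLoss_mem_Icc 0 z w).2).trans (by simp)

theorem measurable_popRisk (μ : Measure (Sample d)) [IsProbabilityMeasure μ] :
    Measurable (popRisk μ) := by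
  unfold popRisk
  exact (StronglyMeasurable.integral_prod_left' (μ := μ)
    (measurable_marginLoss 0).stronglyMeasurable).measurable

theorem integral_empRisk_pi (hn : 0 < n) (μ : Measure (Sample d)) [IsProbabilityMeasure μ]
    (w : Feat d) :
    ∫ s, empRisk 0 s w ∂(Measure.pi fun _ : Fin n => μ) = popRisk μ w := by
  have hn' : (n : ℝ) ≠ 0 := by exact_mod_cast hn.ne'
  have h1 : ∀ i : Fin n, MeasurePreserving (Function.eval i) (Measure.pi fun _ : Fin n => μ) μ :=
    fun i => measurePreserving_eval (fun _ : Fin n => μ) i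
  unfold empRisk
  rw [integral_const_mul, integral_finsetSum]
  · have h2 : ∀ i : Fin n, ∫ s, marginLoss 0 (s i) w ∂(Measure.pi fun _ : Fin n => μ) =
        popRisk μ w := by
      intro i
      have := integral_map (h1 i).measurable.aemeasurable (f := fun z => marginLoss 0 z w)
        (by rw [(h1 i).map_eq]; exact (integrable_marginLoss 0 μ w).aestronglyMeasurable)
      rw [(h1 i).map_eq] at this
      exact this.symm
    simp only [h2]
    simp
    field_simp
  · intro i _
    exact (h1 i).integrable_comp_of_integrable (integrable_marginLoss 0 μ w)

end Risk

/-! ### Support, independence and exponential moments in the distributed setup -/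

namespace Setup

variable {d n K M r : ℕ} (P : Setup d n K M r)

theorem K_pos (P : Setup d n K M r) : 0 < K := by
  have h1 := P.M_le_K
  have h2 := P.one_le_r
  have h3 := P.r_le_M
  omega

instance isProb_μ (k : Fin K) : IsProbabilityMeasure (P.μ k) := by
  have := P.isProb
  constructor
  simp only [μ, Measure.coe_finsetSum, Finset.sum_apply, Measure.smul_apply, measure_univ]
  have h := P.α_row k
  have : ∀ x : ℝ≥0, x • (1 : ENNReal) = x := fun x => by simp [ENNReal.smul_def]
  simp only [this]
  rw [← ENNReal.ofNNReal_finsetSum, h]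
  simp

instance isMarkov_alg (k : Fin K) : IsMarkovKernel (P.alg k) := P.alg_markov k

instance isProb_law : IsProbabilityMeasure P.law := by unfold law; infer_instance

/-- The point `b k` is a convex combination of the centers in the window. -/
theorem norm_a_sub_b_le (k : Fin K) {m : Fin M} (hm : m ∈ window M r k) :
    ‖P.a m - P.b k‖ ≤ P.D k := by
  have h1 : ∑ m' ∈ window M r k, (P.α k m' : ℝ) = 1 := by exact_mod_cast P.α_row k
  have h2 : P.a m - P.b k = ∑ m' ∈ window M r k, (P.α k m' : ℝ) • (P.a m - P.a m') := by
    simp only [smul_sub, Finset.sum_sub_distrib, ← Finset.sum_smul, h1, one_smul, b]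
  rw [h2]
  calc ‖∑ m' ∈ window M r k, (P.α k m' : ℝ) • (P.a m - P.a m')‖
      ≤ ∑ m' ∈ window M r k, (P.α k m' : ℝ) * P.D k := by
        refine norm_sum_le_of_le _ fun m' hm' => ?_
        rw [norm_smul, Real.norm_of_nonneg (NNReal.coe_nonneg (P.α k m'))]
        refine mul_le_mul_of_nonneg_left ?_ (NNReal.coe_nonneg (P.α k m'))
        have := Finset.le_sup (f := fun p : Fin M × Fin M => ‖P.a p.1 - P.a p.2‖₊)
          (Finset.mem_product.2 ⟨hm, hm'⟩ : (m, m') ∈ window M r k ×ˢ window M r k)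
        exact_mod_cast this
    _ = P.D k := by rw [← Finset.sum_mul, h1, one_mul]

theorem ρk_pos (k : Fin K) : 0 < P.ρk k := add_pos_of_pos_of_nonneg P.ρ_pos (NNReal.coe_nonneg _)

theorem ae_norm_sub_b_le (k : Fin K) : ∀ᵐ z ∂(P.μ k), ‖z.1 - P.b k‖ ≤ P.ρk k := by
  unfold μ
  rw [ae_finsetSum_measure_iff]
  intro m hm
  refine Measure.ae_smul_measure ?_ _
  filter_upwards [P.supp m] with z hz
  have h1 := P.norm_a_sub_b_le k hm
  calc ‖z.1 - P.b k‖ = ‖(z.1 - P.a m) + (P.a m - P.b k)‖ := by congr 1; abel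
    _ ≤ _ := (norm_add_le _ _).trans (add_le_add hz h1)

theorem ae_pi_norm_sub_b_le (k : Fin K) :
    ∀ᵐ s ∂(Measure.pi fun _ : Fin n => P.μ k), ∀ i, ‖(s i).1 - P.b k‖ ≤ P.ρk k := by
  rw [ae_all_iff]
  intro i
  exact (measurePreserving_eval (fun _ : Fin n => P.μ k) i).quasiMeasurePreserving.ae
    (P.ae_norm_sub_b_le k)

theorem measurePreserving_eval_law (k : Fin K) : MeasurePreserving (Function.eval k) P.law
    ((Measure.pi fun _ : Fin n => P.μ k) ⊗ₘ P.alg k) :=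
  measurePreserving_eval (fun k => (Measure.pi fun _ : Fin n => P.μ k) ⊗ₘ P.alg k) k

theorem ae_law_norm_sub_b_le (k : Fin K) :
    ∀ᵐ ω ∂P.law, ∀ i, ‖((ω k).1 i).1 - P.b k‖ ≤ P.ρk k := by
  refine (P.measurePreserving_eval_law k).quasiMeasurePreserving.ae
    (p := fun x => ∀ i, ‖(x.1 i).1 - P.b k‖ ≤ P.ρk k) ?_
  have h : MeasurePreserving Prod.fst ((Measure.pi fun _ : Fin n => P.μ k) ⊗ₘ P.alg k)
      (Measure.pi fun _ : Fin n => P.μ k) := ⟨measurable_fst, Measure.fst_compProd _ _⟩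
  exact h.quasiMeasurePreserving.ae (P.ae_pi_norm_sub_b_le k)

theorem ae_law_norm_le_one (k : Fin K) : ∀ᵐ ω ∂P.law, ‖(ω k).2‖ ≤ 1 := by
  refine (P.measurePreserving_eval_law k).quasiMeasurePreserving.ae
    (p := fun x => ‖x.2‖ ≤ 1) ?_
  rw [Measure.ae_compProd_iff (measurableSet_le (by fun_prop) measurable_const)]
  exact Filter.Eventually.of_forall fun s => P.alg_ball k s

/-- The contribution of the other clients to the aggregated hypothesis. -/
noncomputable def others (k : Fin K) (ω : Fin K → (Fin n → Sample d) × Feat d) : Feat d :=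
  (1 / (K : ℝ)) • ∑ j ∈ Finset.univ.erase k, (ω j).2

theorem avg_eq (k : Fin K) (ω : Fin K → (Fin n → Sample d) × Feat d) :
    avg ω = others k ω + (1 / (K : ℝ)) • (ω k).2 := by
  rw [avg, others, ← smul_add, Finset.sum_erase_add _ _ (Finset.mem_univ k)]

theorem others_update (k : Fin K) (ω : Fin K → (Fin n → Sample d) × Feat d)
    (x : (Fin n → Sample d) × Feat d) : others k (Function.update ω k x) = others k ω := by
  unfold others
  congr 1
  refine Finset.sum_congr rfl fun j hj => ?_
  rw [Function.update_of_ne (Finset.ne_of_mem_erase hj)]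

@[fun_prop]
theorem measurable_others (k : Fin K) :
    Measurable (others k : (Fin K → (Fin n → Sample d) × Feat d) → Feat d) := by
  unfold others; fun_prop

@[fun_prop]
theorem measurable_avg : Measurable (avg : (Fin K → (Fin n → Sample d) × Feat d) → Feat d) := by
  unfold avg; fun_prop

theorem lintegral_law_le (k : Fin K) {f : (Fin K → (Fin n → Sample d) × Feat d) → ENNReal}
    (hf : Measurable f) {c : ENNReal} (h : ∀ ω, ∫⁻ x, f (Function.update ω k x)
      ∂((Measure.pi fun _ : Fin n => P.μ k) ⊗ₘ P.alg k) ≤ c) : ∫⁻ ω, f ω ∂P.law ≤ c := by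
  -- Any base point serves: a marginal over all coordinates does not see it.
  obtain ⟨ω₀⟩ : Nonempty (Fin K → (Fin n → Sample d) × Feat d) :=
    ⟨fun _ => (fun _ => (0, ⟨1, by simp⟩), 0)⟩
  unfold law
  rw [lintegral_eq_lmarginal_univ ω₀, lmarginal_erase' _ hf (Finset.mem_univ k)]
  refine (lmarginal_mono (g := fun _ => c) h ω₀).trans ?_
  simp [lmarginal]

/-- Given the other clients, `others k` is constant and the integrand does not involve `W_k`. The
kernel of client `k` therefore drops out, and only its i.i.d. sample and the ghost sample remain. -/
theorem lintegral_sumExpHD_law_le (hn : 0 < n) (θ : ℝ) (k : Fin K) :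
    ∫⁻ x, ENNReal.ofReal (sumExpHD K θ (P.ρk k) (P.b k) (others k x.1) (x.1 k).1 x.2)
      ∂(P.law.prod (Measure.pi fun _ : Fin n => P.μ k)) ≤
      ENNReal.ofReal (momentBound n K θ (P.ρk k) ‖P.b k‖) := by
  have hm : Measurable fun x : (Fin K → (Fin n → Sample d) × Feat d) × (Fin n → Sample d) =>
      ENNReal.ofReal (sumExpHD K θ (P.ρk k) (P.b k) (others k x.1) (x.1 k).1 x.2) :=
    ((measurable_sumExpHD K θ (P.ρk k) (P.b k)).comp (f := fun x :
      (Fin K → (Fin n → Sample d) × Feat d) × (Fin n → Sample d) =>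
        (others k x.1, (x.1 k).1, x.2)) (by fun_prop)).ennreal_ofReal
  rw [lintegral_prod _ hm.aemeasurable]
  refine P.lintegral_law_le k hm.lintegral_prod_right' fun ω => ?_
  simp only [others_update, Function.update_self]
  have hmp : MeasurePreserving Prod.fst ((Measure.pi fun _ : Fin n => P.μ k) ⊗ₘ P.alg k)
      (Measure.pi fun _ : Fin n => P.μ k) := ⟨measurable_fst, Measure.fst_compProd _ _⟩
  have hm2 : Measurable fun s : Fin n → Sample d => ∫⁻ s',
      ENNReal.ofReal (sumExpHD K θ (P.ρk k) (P.b k) (others k ω) s s')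
        ∂(Measure.pi fun _ : Fin n => P.μ k) :=
    Measurable.lintegral_prod_right' (f := fun x : (Fin n → Sample d) × (Fin n → Sample d) =>
      ENNReal.ofReal (sumExpHD K θ (P.ρk k) (P.b k) (others k ω) x.1 x.2))
      ((measurable_sumExpHD K θ (P.ρk k) (P.b k)).comp (f := fun x :
        (Fin n → Sample d) × (Fin n → Sample d) =>
        (others k ω, x.1, x.2)) (by fun_prop)).ennreal_ofReal
  rw [hmp.lintegral_comp hm2]
  exact lintegral_sumExpHD_le hn K θ (P.ρk k) (P.b k) (others k ω) (P.μ k)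

end Setup

/-! ### From exponential moments to expected risks -/

theorem polyFactor_pos (n : ℕ) : 0 < polyFactor n := by unfold polyFactor; positivity

theorem momentBound_pos {n : ℕ} (hn : 0 < n) (K : ℕ) (θ ρ β : ℝ) : 0 < momentBound n K θ ρ β := by
  have hn' : (0 : ℝ) < n := by exact_mod_cast hn
  have := polyFactor_pos n
  unfold momentBound; positivity

/-- Jensen's inequality, obtained by integrating the tangent bound of `exp` at `Real.log Z`. -/
theorem le_log_of_lintegral_exp_le {Ω : Type*} [MeasurableSpace Ω] {Q : Measure Ω}
    [IsProbabilityMeasure Q] {F : Ω → ℝ} (hF : Measurable F) {R : ℝ} (hR : ∀ ω, |F ω| ≤ R)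
    {Z : ℝ} (hZ : 0 < Z) (h : ∫⁻ ω, ENNReal.ofReal (Real.exp (F ω)) ∂Q ≤ ENNReal.ofReal Z) :
    ∫ ω, F ω ∂Q ≤ Real.log Z := by
  have hFi : Integrable F Q := Integrable.of_mem_Icc (-R) R hF.aemeasurable
    (Filter.Eventually.of_forall fun ω => abs_le.1 (hR ω))
  have hEi : Integrable (fun ω => Real.exp (F ω)) Q := Integrable.of_mem_Icc 0 (Real.exp R)
    hF.exp.aemeasurable (Filter.Eventually.of_forall fun ω =>
      ⟨(Real.exp_pos _).le, Real.exp_le_exp.2 (abs_le.1 (hR ω)).2⟩)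
  have hE : ∫ ω, Real.exp (F ω) ∂Q ≤ Z := by
    rw [← ofReal_integral_eq_lintegral_ofReal hEi
      (Filter.Eventually.of_forall fun ω => (Real.exp_pos _).le)] at h
    exact (ENNReal.ofReal_le_ofReal_iff hZ.le).1 h
  have h1 : ∀ ω, F ω ≤ Real.exp (F ω) / Z + (Real.log Z - 1) := by
    intro ω
    have := Real.add_one_le_exp (F ω - Real.log Z)
    rw [Real.exp_sub, Real.exp_log hZ] at this
    linarith
  have h2 := integral_mono hFi ((hEi.div_const Z).add (integrable_const (Real.log Z - 1))) h1
  simp only [Pi.add_apply] at h2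
  rw [integral_add (hEi.div_const Z) (integrable_const _), integral_div] at h2
  simp only [integral_const, probReal_univ, one_smul] at h2
  have h3 : (∫ ω, Real.exp (F ω) ∂Q) / Z ≤ 1 := (div_le_one hZ).2 hE
  linarith

theorem average_mem_Icc {K : ℕ} (hK : 0 < K) {f : Fin K → ℝ}
    (hf : ∀ k, f k ∈ Set.Icc (0 : ℝ) 1) : (1 / (K : ℝ)) * ∑ k, f k ∈ Set.Icc (0 : ℝ) 1 := by
  have hK' : (0 : ℝ) < K := by exact_mod_cast hK
  refine ⟨mul_nonneg (by positivity) (Finset.sum_nonneg fun k _ => (hf k).1), ?_⟩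
  rw [one_div, inv_mul_le_iff₀ hK', mul_one]
  exact (Finset.sum_le_card_nsmul _ _ 1 fun k _ => (hf k).2).trans (by simp)

theorem integral_mem_Icc {Ω : Type*} [MeasurableSpace Ω] {Q : Measure Ω}
    [IsProbabilityMeasure Q] {F : Ω → ℝ} (hF : ∀ ω, F ω ∈ Set.Icc (0 : ℝ) 1)
    (hi : Integrable F Q) : ∫ ω, F ω ∂Q ∈ Set.Icc (0 : ℝ) 1 :=
  ⟨integral_nonneg fun ω => (hF ω).1,
    (integral_mono hi (integrable_const 1) fun ω => (hF ω).2).trans (by simp)⟩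

namespace Setup

variable {d n K M r : ℕ} (P : Setup d n K M r)

theorem integrable_popRisk (k : Fin K) : Integrable (fun ω => popRisk (P.μ k) (avg ω)) P.law :=
  Integrable.of_mem_Icc 0 1 ((measurable_popRisk (P.μ k)).comp measurable_avg).aemeasurable
    (Filter.Eventually.of_forall fun _ => popRisk_mem_Icc _ _)

theorem integrable_empRisk (hn : 0 < n) (θ : ℝ) (k : Fin K) :
    Integrable (fun ω => empRisk θ (ω k).1 (avg ω)) P.law :=
  Integrable.of_mem_Icc 0 1 ((measurable_empRisk θ).comp
    (f := fun ω : Fin K → (Fin n → Sample d) × Feat d => ((ω k).1, avg ω))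
    (by fun_prop)).aemeasurable (Filter.Eventually.of_forall fun _ => empRisk_mem_Icc hn _ _ _)

/-- The ghost sample is independent of the whole experiment, so its mean empirical risk at the
aggregate is the population risk. -/
theorem affine_risk_le (hn : 0 < n) {θ : ℝ} (hθ : 0 < θ) (k : Fin K) {p q t : ℝ} (hp : 0 ≤ p)
    (hq : q ≤ 0) (hpq : ∀ x ∈ Set.Icc (0 : ℝ) 1, ∀ c ∈ Set.Icc (0 : ℝ) 1,
      p * x + q * c + t ≤ hD x c) :
    n * (p * ∫ ω, popRisk (P.μ k) (avg ω) ∂P.law + q * ∫ ω, empRisk θ (ω k).1 (avg ω) ∂P.law + t) ≤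
      Real.log (momentBound n K θ (P.ρk k) ‖P.b k‖) := by
  set Q := P.law.prod (Measure.pi fun _ : Fin n => P.μ k) with hQ
  have hm1 : Measurable fun x : (Fin K → (Fin n → Sample d) × Feat d) × (Fin n → Sample d) =>
      empRisk 0 x.2 (avg x.1) := (measurable_empRisk 0).comp (f := fun x :
    (Fin K → (Fin n → Sample d) × Feat d) × (Fin n → Sample d) => (x.2, avg x.1)) (by fun_prop)
  have hm2 : Measurable fun x : (Fin K → (Fin n → Sample d) × Feat d) × (Fin n → Sample d) =>
      empRisk θ (x.1 k).1 (avg x.1) := (measurable_empRisk θ).comp (f := fun x :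
    (Fin K → (Fin n → Sample d) × Feat d) × (Fin n → Sample d) => ((x.1 k).1, avg x.1))
      (by fun_prop)
  have hi1 : Integrable (fun x => empRisk 0 x.2 (avg x.1)) Q :=
    Integrable.of_mem_Icc 0 1 hm1.aemeasurable
      (Filter.Eventually.of_forall fun _ => empRisk_mem_Icc hn _ _ _)
  have hi2 : Integrable (fun x => empRisk θ (x.1 k).1 (avg x.1)) Q :=
    Integrable.of_mem_Icc 0 1 hm2.aemeasurable
      (Filter.Eventually.of_forall fun _ => empRisk_mem_Icc hn _ _ _)
  have e1 : ∫ x, empRisk 0 x.2 (avg x.1) ∂Q = ∫ ω, popRisk (P.μ k) (avg ω) ∂P.law := by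
    rw [hQ, integral_prod _ hi1]
    exact integral_congr_ae (Filter.Eventually.of_forall fun ω =>
      integral_empRisk_pi hn (P.μ k) (avg ω))
  have e2 : ∫ x, empRisk θ (x.1 k).1 (avg x.1) ∂Q = ∫ ω, empRisk θ (ω k).1 (avg ω) ∂P.law := by
    rw [hQ, integral_prod _ hi2]
    simp
  have key := le_log_of_lintegral_exp_le (Q := Q)
    (F := fun x => n * (p * empRisk 0 x.2 (avg x.1) + q * empRisk θ (x.1 k).1 (avg x.1) + t))
    ((((hm1.const_mul p).add (hm2.const_mul q)).add_const t).const_mul _)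
    (R := n * (|p| + |q| + |t|)) (fun x => by
      have h1 := empRisk_mem_Icc hn 0 x.2 (avg x.1)
      have h2 := empRisk_mem_Icc hn θ (x.1 k).1 (avg x.1)
      rw [abs_mul, Nat.abs_cast]
      gcongr
      refine (abs_add_le _ _).trans (add_le_add ((abs_add_le _ _).trans (add_le_add ?_ ?_)) le_rfl)
      · rw [abs_mul, abs_of_nonneg h1.1]; exact mul_le_of_le_one_right (abs_nonneg _) h1.2
      · rw [abs_mul, abs_of_nonneg h2.1]; exact mul_le_of_le_one_right (abs_nonneg _) h2.2)
    (momentBound_pos hn K θ (P.ρk k) ‖P.b k‖) (by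
      refine le_trans (lintegral_mono_ae ?_) (P.lintegral_sumExpHD_law_le hn θ k)
      have a1 := Measure.quasiMeasurePreserving_fst (μ := P.law)
        (ν := Measure.pi fun _ : Fin n => P.μ k) |>.ae (P.ae_law_norm_sub_b_le k)
      have a2 := Measure.quasiMeasurePreserving_fst (μ := P.law)
        (ν := Measure.pi fun _ : Fin n => P.μ k) |>.ae (P.ae_law_norm_le_one k)
      have a3 := Measure.quasiMeasurePreserving_snd (μ := P.law)
        (ν := Measure.pi fun _ : Fin n => P.μ k) |>.ae (P.ae_pi_norm_sub_b_le k)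
      filter_upwards [a1, a2, a3] with x h1 h2 h3
      refine ENNReal.ofReal_le_ofReal ?_
      rw [avg_eq k]
      exact exp_affine_le_sumExpHD hn P.K_pos hθ (P.ρk_pos k) (P.b k) (others k x.1) (x.1 k).2 h2
        (x.1 k).1 x.2 h1 h3 hp hq hpq)
  have hi3 : Integrable (fun x => p * empRisk 0 x.2 (avg x.1) +
      q * empRisk θ (x.1 k).1 (avg x.1)) Q := (hi1.const_mul p).add (hi2.const_mul q)
  rw [integral_const_mul, integral_add hi3 (integrable_const t),
    integral_add (hi1.const_mul p) (hi2.const_mul q), integral_const_mul, integral_const_mul,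
    e1, e2] at key
  simpa using key

/-- The expected population risk of the aggregated hypothesis, averaged over the clients. -/
noncomputable def expPop : ℝ := (1 / (K : ℝ)) * ∑ k, ∫ ω, popRisk (P.μ k) (avg ω) ∂P.law

theorem expEmp_eq (hn : 0 < n) (θ : ℝ) :
    P.expEmp θ = (1 / (K : ℝ)) * ∑ k, ∫ ω, empRisk θ (ω k).1 (avg ω) ∂P.law := by
  rw [expEmp, integral_const_mul, integral_finsetSum _ fun k _ => P.integrable_empRisk hn θ k]

theorem expGen_eq (hn : 0 < n) (θ : ℝ) : P.expGen θ = P.expPop - P.expEmp θ := by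
  rw [P.expEmp_eq hn, expPop, expGen]
  simp only [gen]
  have hi : ∀ k : Fin K, Integrable (fun ω => popRisk (P.μ k) (avg ω) -
      empRisk θ (ω k).1 (avg ω)) P.law := fun k =>
    (P.integrable_popRisk k).sub (P.integrable_empRisk hn θ k)
  rw [integral_const_mul, integral_finsetSum _ fun k _ => hi k, ← mul_sub,
    ← Finset.sum_sub_distrib]
  congr 1
  exact Finset.sum_congr rfl fun k _ =>
    integral_sub (P.integrable_popRisk k) (P.integrable_empRisk hn θ k)

theorem expPop_mem_Icc : P.expPop ∈ Set.Icc (0 : ℝ) 1 :=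
  average_mem_Icc P.K_pos fun k =>
    integral_mem_Icc (fun _ => popRisk_mem_Icc _ _) (P.integrable_popRisk k)

theorem expEmp_mem_Icc (hn : 0 < n) (θ : ℝ) : P.expEmp θ ∈ Set.Icc (0 : ℝ) 1 := by
  rw [P.expEmp_eq hn]
  exact average_mem_Icc P.K_pos fun k =>
    integral_mem_Icc (fun _ => empRisk_mem_Icc hn _ _ _) (P.integrable_empRisk hn θ k)

/-- The average over the clients of the logarithmic exponential moments, per sample. -/
noncomputable def rate (θ : ℝ) : ℝ :=
  (1 / ((n : ℝ) * K)) * ∑ k, Real.log (momentBound n K θ (P.ρk k) ‖P.b k‖)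

theorem affine_expPop_le_rate (hn : 0 < n) {θ : ℝ} (hθ : 0 < θ) {p q t : ℝ} (hp : 0 ≤ p)
    (hq : q ≤ 0) (hpq : ∀ x ∈ Set.Icc (0 : ℝ) 1, ∀ c ∈ Set.Icc (0 : ℝ) 1,
      p * x + q * c + t ≤ hD x c) : p * P.expPop + q * P.expEmp θ + t ≤ P.rate θ := by
  have hK : (0 : ℝ) < K := by exact_mod_cast P.K_pos
  have hn' : (0 : ℝ) < n := by exact_mod_cast hn
  have h := Finset.sum_le_sum fun k (_ : k ∈ Finset.univ) => P.affine_risk_le hn hθ k hp hq hpq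
  rw [← Finset.mul_sum, Finset.sum_add_distrib, Finset.sum_add_distrib, ← Finset.mul_sum,
    ← Finset.mul_sum, Finset.sum_const, Finset.card_univ, Fintype.card_fin, nsmul_eq_mul] at h
  rw [P.expEmp_eq hn, expPop, rate, one_div, one_div, le_inv_mul_iff₀ (by positivity)]
  refine le_trans (le_of_eq ?_) h
  field_simp

/-- Supporting planes exist only at interior points, while the risks may be `0` or `1`. The pair is
therefore moved slightly towards the diagonal; the monotonicity of the plane makes this move
favourable, and continuity removes it. -/
theorem hD_expPop_le_rate (hn : 0 < n) {θ : ℝ} (hθ : 0 < θ) (hlt : P.expEmp θ < P.expPop) :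
    hD P.expPop (P.expEmp θ) ≤ P.rate θ := by
  set A := P.expPop with hA
  set L := P.expEmp θ with hL
  have hA1 := P.expPop_mem_Icc
  have hL1 := P.expEmp_mem_Icc hn θ
  have hc : Continuous fun s : ℝ => hD (A - s * (A - L)) (L + s * (A - L)) :=
    continuous_hD.comp (by fun_prop : Continuous fun s : ℝ => (A - s * (A - L), L + s * (A - L)))
  have hlim := (hc.tendsto 0).mono_left (nhdsWithin_le_nhds (s := Set.Ioi 0))
  simp only [zero_mul, sub_zero, add_zero] at hlim
  refine le_of_tendsto hlim ?_
  filter_upwards [Ioo_mem_nhdsGT (show (0 : ℝ) < 1 / 2 by norm_num)] with s hs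
  have h1 : 0 < s * (A - L) := mul_pos hs.1 (sub_pos.2 hlt)
  have h2 : s * (A - L) < 1 / 2 * (A - L) := mul_lt_mul_of_pos_right hs.2 (sub_pos.2 hlt)
  obtain ⟨p, q, t, hp, hq, heq, hle⟩ := exists_tangent (A := A - s * (A - L))
    (B := L + s * (A - L)) (by linarith [hL1.1]) (by linarith) (by linarith [hA1.2])
  have h3 := P.affine_expPop_le_rate hn hθ hp hq hle
  rw [← heq]
  refine le_trans ?_ h3
  have h4 : p * (A - s * (A - L)) ≤ p * A := mul_le_mul_of_nonneg_left (by linarith) hp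
  have h5 : q * (L + s * (A - L)) ≤ q * L := mul_le_mul_of_nonpos_left (by linarith) hq
  linarith

end Setup

/-! ### Explicit bounds for the rate -/

theorem half_le_log {n : ℕ} (hn : 2 ≤ n) : 1 / 2 ≤ Real.log n := by
  have h1 : Real.log 2 ≤ Real.log n := Real.log_le_log (by norm_num) (by exact_mod_cast hn)
  linarith [Real.log_two_gt_d9]

theorem log_polyFactor_le {n : ℕ} (hn : 2 ≤ n) : Real.log (polyFactor n) ≤ 11 * Real.log n := by
  have hn' : (2 : ℝ) ≤ n := by exact_mod_cast hn
  have h : polyFactor n ≤ (n : ℝ) ^ 11 := by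
    have h1 : (8 : ℝ) ≤ (n : ℝ) ^ 3 := by
      calc (8 : ℝ) = 2 ^ 3 := by norm_num
        _ ≤ _ := by gcongr
    have h2 : 2 * (n : ℝ) + 1 ≤ (n : ℝ) ^ 3 := by nlinarith [mul_self_nonneg ((n : ℝ) - 2)]
    have h3 : (n : ℝ) + 1 ≤ (n : ℝ) ^ 2 := by nlinarith
    calc polyFactor n ≤ (n : ℝ) ^ 3 * ((n : ℝ) ^ 3) ^ 2 * (n : ℝ) ^ 2 := by
          unfold polyFactor; gcongr
      _ = _ := by ring
  have := Real.log_le_log (polyFactor_pos n) h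
  rwa [Real.log_pow] at this

theorem log_momentBound_le {n K : ℕ} (hn : 2 ≤ n) (hK : 0 < K) {θ ρ β : ℝ} (hθ : 0 < θ)
    (hρ : 0 < ρ) (hβ : 0 ≤ β) : Real.log (momentBound n K θ ρ β) ≤
      64 * ((ρ / (K * θ)) ^ 2 * Real.log n) + Real.log (max 1 (4 * n * β / (K * θ))) +
        12 * Real.log n := by
  have hn' : (2 : ℝ) ≤ n := by exact_mod_cast hn
  have hK' : (0 : ℝ) < K := by exact_mod_cast hK
  have hln := half_le_log hn
  unfold momentBound
  have hp := polyFactor_pos n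
  rw [Real.log_mul (by positivity) hp.ne', Real.log_mul (by positivity) (by positivity),
    Real.log_pow]
  have h1 : Real.log (6 * n) ≤ 4 * Real.log n := by
    have h8 : (6 : ℝ) * n ≤ (n : ℝ) ^ 4 := by
      have : (8 : ℝ) ≤ (n : ℝ) ^ 3 := by
        calc (8 : ℝ) = 2 ^ 3 := by norm_num
          _ ≤ _ := by gcongr
      nlinarith
    have := Real.log_le_log (by positivity) h8
    rwa [Real.log_pow] at this
  have h2 : (⌊(ρ / (K * θ / 4)) ^ 2⌋₊ : ℝ) ≤ 16 * (ρ / (K * θ)) ^ 2 := by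
    refine (Nat.floor_le (by positivity)).trans (le_of_eq ?_)
    field_simp; ring
  have h3 : (⌊(ρ / (K * θ / 4)) ^ 2⌋₊ : ℝ) * Real.log (6 * n) ≤
      64 * ((ρ / (K * θ)) ^ 2 * Real.log n) := by
    calc (⌊(ρ / (K * θ / 4)) ^ 2⌋₊ : ℝ) * Real.log (6 * n)
        ≤ 16 * (ρ / (K * θ)) ^ 2 * (4 * Real.log n) := by
          have : 0 ≤ Real.log (6 * n) := Real.log_nonneg (by linarith)
          gcongr
      _ = _ := by ring
  set a := max 1 (4 * n * β / (K * θ)) with ha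
  have ha1 : 1 ≤ a := le_max_left _ _
  have h4 : Real.log ((⌊2 * β / (K * θ / 4)⌋₊ : ℝ) + 1) ≤ Real.log n + Real.log a := by
    rw [← Real.log_mul (by positivity) (by positivity)]
    refine Real.log_le_log (by positivity) ?_
    have h5 : (⌊2 * β / (K * θ / 4)⌋₊ : ℝ) ≤ a := by
      refine (Nat.floor_le (by positivity)).trans (le_trans ?_ (le_max_right _ _))
      -- Here `2 ≤ n` turns the factor `4 * 2` into `4 * n`.
      rw [show 2 * β / (K * θ / 4) = 4 * 2 * β / (K * θ) by field_simp]
      gcongr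
    nlinarith
  linarith [log_polyFactor_le hn]

/-- The constant of the fast rate for radii and centers of norm at most `B θ`. -/
noncomputable def fastConst (B : ℝ) : ℝ :=
  64 * B ^ 2 + 13 + 2 * Real.log (4 * (|B| + 1))

namespace Setup

variable {d n K M r : ℕ} (P : Setup d n K M r)

theorem Ehat_nonneg (hn : 2 ≤ n) (θ : ℝ) : 0 ≤ P.Ehat θ := by
  have hK : (1 : ℝ) ≤ K := by exact_mod_cast P.K_pos
  have hn' : (2 : ℝ) ≤ n := by exact_mod_cast hn
  unfold Ehat
  refine mul_nonneg (by positivity) (Finset.sum_nonneg fun k _ => ?_)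
  have h1 : 0 ≤ Real.log (n * K) := Real.log_nonneg (by nlinarith)
  have h2 : 0 ≤ Real.log (max 3 (K * θ / P.ρk k)) :=
    Real.log_nonneg (le_trans (by norm_num) (le_max_left _ _))
  have h3 : 0 ≤ Real.log (max 1 (4 * n * ‖P.b k‖ / (K * θ))) := Real.log_nonneg (le_max_left _ _)
  positivity

/-- The logarithmic factors in `Ehat` only enlarge it: `log n ≤ log (n K)`, and the logarithm of a
number at least `3` is at least `1`. -/
theorem rate_le_Ehat (hn : 2 ≤ n) {θ : ℝ} (hθ : 0 < θ) :
    P.rate θ ≤ 64 * (P.Ehat θ + Real.log n / n) := by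
  have hK : (1 : ℝ) ≤ K := by exact_mod_cast P.K_pos
  have hn' : (2 : ℝ) ≤ n := by exact_mod_cast hn
  have hln := half_le_log hn
  have h : ∀ k : Fin K, Real.log (momentBound n K θ (P.ρk k) ‖P.b k‖) ≤
      64 * (((P.ρk k / (K * θ)) ^ 2 * Real.log (n * K) * Real.log (max 3 (K * θ / P.ρk k))
      + Real.log (max 1 (4 * n * ‖P.b k‖ / (K * θ)))) + Real.log n) := by
    intro k
    have h1 := log_momentBound_le hn P.K_pos hθ (P.ρk_pos k) (norm_nonneg (P.b k))
    have h2 : 1 ≤ Real.log (max 3 (K * θ / P.ρk k)) := by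
      rw [Real.le_log_iff_exp_le (by positivity)]
      exact le_trans (by linarith [Real.exp_one_lt_d9]) (le_max_left _ _)
    have h3 : Real.log n ≤ Real.log (n * K) := Real.log_le_log (by positivity) (by nlinarith)
    have h4 : 0 ≤ Real.log (max 1 (4 * n * ‖P.b k‖ / (K * θ))) :=
      Real.log_nonneg (le_max_left _ _)
    have h5 : (P.ρk k / (K * θ)) ^ 2 * Real.log n ≤
        (P.ρk k / (K * θ)) ^ 2 * Real.log (n * K) * Real.log (max 3 (K * θ / P.ρk k)) := by
      calc (P.ρk k / (K * θ)) ^ 2 * Real.log n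
          ≤ (P.ρk k / (K * θ)) ^ 2 * Real.log (n * K) * 1 := by rw [mul_one]; gcongr
        _ ≤ _ := by
          have : 0 ≤ Real.log (n * K) := by linarith
          gcongr
    linarith
  have hsum := Finset.sum_le_sum fun k (_ : k ∈ Finset.univ) => h k
  rw [← Finset.mul_sum, Finset.sum_add_distrib, Finset.sum_const, Finset.card_univ,
    Fintype.card_fin, nsmul_eq_mul] at hsum
  have e : 1 / ((n : ℝ) * K) * (K * Real.log n) = Real.log n / n := by field_simp
  unfold rate Ehat
  refine (mul_le_mul_of_nonneg_left hsum (by positivity)).trans (le_of_eq ?_)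
  linear_combination 64 * e

theorem rate_le_fastConst (hn : 2 ≤ n) {θ B : ℝ} (hθ : 0 < θ) (hρ : ∀ k, P.ρk k ≤ B * θ)
    (hb : ∀ k, ‖P.b k‖ ≤ B * θ) : P.rate θ ≤ fastConst B * (Real.log n / n) := by
  have hK : (1 : ℝ) ≤ K := by exact_mod_cast P.K_pos
  have hn' : (2 : ℝ) ≤ n := by exact_mod_cast hn
  have hln := half_le_log hn
  have hB : 0 < B := pos_of_mul_pos_left ((P.ρk_pos ⟨0, P.K_pos⟩).trans_le (hρ _)) hθ.le
  have h : ∀ k : Fin K, Real.log (momentBound n K θ (P.ρk k) ‖P.b k‖) ≤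
      fastConst B * Real.log n := by
    intro k
    have h1 := log_momentBound_le hn P.K_pos hθ (P.ρk_pos k) (norm_nonneg (P.b k))
    have h2 : (P.ρk k / (K * θ)) ^ 2 ≤ B ^ 2 := by
      have := P.ρk_pos k
      refine pow_le_pow_left₀ (by positivity) ?_ 2
      rw [div_le_iff₀ (by positivity)]
      refine (hρ k).trans ?_
      have : B * θ * 1 ≤ B * θ * K := by gcongr
      linarith
    have h3 : max 1 (4 * n * ‖P.b k‖ / (K * θ)) ≤ n * (4 * (|B| + 1)) := by
      rw [abs_of_pos hB]
      refine max_le (by nlinarith) ?_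
      rw [div_le_iff₀ (by positivity)]
      calc 4 * n * ‖P.b k‖ ≤ 4 * n * (B * θ) * 1 := by rw [mul_one]; gcongr; exact hb k
        _ ≤ 4 * n * ((B + 1) * θ) * K := by gcongr; linarith
        _ = _ := by ring
    have h4 := Real.log_le_log (by positivity) h3
    rw [Real.log_mul (by positivity) (by positivity)] at h4
    have h5 : 0 ≤ Real.log (4 * (|B| + 1)) := Real.log_nonneg (by linarith [abs_nonneg B])
    have h6 : (P.ρk k / (K * θ)) ^ 2 * Real.log n ≤ B ^ 2 * Real.log n := by gcongr
    -- The `13` is `12` from the moment bound plus `1` from the factor `n` in `h3`; the constant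
    -- logarithm is doubled because `1 / 2 ≤ Real.log n`.
    unfold fastConst
    nlinarith
  have hsum := Finset.sum_le_sum fun k (_ : k ∈ Finset.univ) => h k
  rw [Finset.sum_const, Finset.card_univ, Fintype.card_fin, nsmul_eq_mul] at hsum
  unfold rate
  refine (mul_le_mul_of_nonneg_left hsum (by positivity)).trans (le_of_eq ?_)
  field_simp

end Setup

/-- It suffices that `72 ≤ K √K log n`. For `K ≥ 36` this follows from `36 * 6 / 2`; for smaller `K`
the hypothesis forces `n ≥ exp 72`. -/
theorem eps_le_log_div {n K : ℕ} (hn : 2 ≤ n) (hK : 0 < K)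
    (h : 36 * ⌈Real.exp 72⌉₊ ≤ n * K) : 72 * eps n K ≤ Real.log n / n := by
  have hK' : (1 : ℝ) ≤ K := by exact_mod_cast hK
  have hn' : (2 : ℝ) ≤ n := by exact_mod_cast hn
  have hs : 1 ≤ Real.sqrt K := Real.one_le_sqrt.2 hK'
  have key : 72 ≤ K * Real.sqrt K * Real.log n := by
    have hln := half_le_log hn
    rcases le_or_gt 36 K with hk | hk
    · have hk' : (36 : ℝ) ≤ K := by exact_mod_cast hk
      have h6 : 6 ≤ Real.sqrt K := by
        rw [Real.le_sqrt (by norm_num) (by positivity)]; linarith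
      calc (72 : ℝ) ≤ 36 * 6 * (1 / 2) := by norm_num
        _ ≤ _ := by gcongr
    · have h1 : ⌈Real.exp 72⌉₊ ≤ n := by
        refine Nat.le_of_mul_le_mul_left (h.trans ?_) (by norm_num : 0 < 36)
        rw [mul_comm]
        gcongr
      have h2 : Real.exp 72 ≤ n := (Nat.le_ceil _).trans (by exact_mod_cast h1)
      have h3 : 72 ≤ Real.log n := (Real.le_log_iff_exp_le (by positivity)).2 h2
      calc (72 : ℝ) = 1 * 1 * 72 := by norm_num
        _ ≤ _ := by gcongr
  unfold eps
  rw [mul_one_div, div_le_div_iff₀ (by positivity) (by positivity)]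
  calc 72 * (n : ℝ) ≤ K * Real.sqrt K * Real.log n * n := by gcongr
    _ = _ := by ring

theorem eps_nonneg (n K : ℕ) : 0 ≤ eps n K := by unfold eps; positivity

theorem log_div_le_fastRate {n K : ℕ} (hn : 2 ≤ n) (hK : 0 < K) :
    Real.log n / n ≤ fastRate n K := by
  have hK' : (1 : ℝ) ≤ K := by exact_mod_cast hK
  have hn' : (2 : ℝ) ≤ n := by exact_mod_cast hn
  have h1 : 0 ≤ Real.log K := Real.log_nonneg hK'
  have h2 : 0 ≤ Real.log ((n : ℝ) * K) := Real.log_nonneg (by nlinarith)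
  unfold fastRate
  have : 0 ≤ Real.log K * Real.log ((n : ℝ) * K) / ((n : ℝ) * (K : ℝ) ^ 2) := by positivity
  linarith

end DSVM

/-! ### The two bounds -/

theorem theorem9 :
    (∃ C : ℝ, 0 < C ∧ ∃ N₀ : ℕ,
      ∀ (d n K M r : ℕ) (P : DSVM.Setup d n K M r) (θ : ℝ),
        0 < θ → θ ≤ 1 → 2 ≤ n → N₀ ≤ n * K →
          P.expGen θ ≤
            C * (DSVM.hDInv (P.Ehat θ + Real.log n / n)
                    (max 0 (P.expEmp θ - 9 * DSVM.eps n K))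
                  - P.expEmp θ + DSVM.eps n K)) ∧
    (∀ B Λ : ℝ, ∃ C : ℝ, 0 < C ∧
      ∀ (d n K M r : ℕ) (P : DSVM.Setup d n K M r) (θ : ℝ),
        0 < θ → θ ≤ 1 → 2 ≤ n →
        (∀ k, P.ρk k ≤ B * θ) → (∀ k, ‖P.b k‖ ≤ B * θ) →
        P.expEmp θ ≤ Λ * DSVM.fastRate n K →
          P.expGen θ ≤ C * DSVM.fastRate n K) := by
  have hk := DSVM.kap_pos
  constructor
  -- The constant of `sub_le_mul_hDInv` at `C₀ = 64`, the factor in `rate_le_Ehat`.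
  · refine ⟨4 * 64 + 4 * (1 + 64 / DSVM.kap), by positivity, 36 * ⌈Real.exp 72⌉₊, ?_⟩
    intro d n K M r P θ hθ _ hn hN
    have hn0 : 0 < n := by omega
    rw [P.expGen_eq hn0]
    have h1 := P.Ehat_nonneg hn θ
    have h2 := DSVM.eps_le_log_div hn P.K_pos hN
    exact DSVM.sub_le_mul_hDInv P.expPop_mem_Icc (P.expEmp_mem_Icc hn0 θ) (DSVM.eps_nonneg n K)
      (by linarith) (by norm_num)
      fun hlt => (P.hD_expPop_le_rate hn0 hθ hlt).trans (P.rate_le_Ehat hn hθ)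
  · intro B Λ
    have hlB : 0 ≤ Real.log (4 * (|B| + 1)) := Real.log_nonneg (by linarith [abs_nonneg B])
    have hfc : 0 < DSVM.fastConst B := by unfold DSVM.fastConst; positivity
    -- These are the two terms of `2 * L + y / kap`, with `L ≤ |Λ| R` and `y = fastConst B * R`.
    refine ⟨2 * |Λ| + DSVM.fastConst B / DSVM.kap, by positivity, ?_⟩
    intro d n K M r P θ hθ _ hn hρ hb hL
    have hn0 : 0 < n := by omega
    have hln := DSVM.half_le_log hn
    rw [P.expGen_eq hn0]
    have hLm := P.expEmp_mem_Icc hn0 θ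
    have hR := DSVM.log_div_le_fastRate hn P.K_pos
    have hR0 : 0 ≤ DSVM.fastRate n K := le_trans (by positivity) hR
    have h1 := DSVM.le_max_of_hD_le P.expPop_mem_Icc hLm
      (y := DSVM.fastConst B * DSVM.fastRate n K) (by positivity) fun hlt =>
        ((P.hD_expPop_le_rate hn0 hθ hlt).trans (P.rate_le_fastConst hn hθ hρ hb)).trans
          (by gcongr)
    have h2 : Λ * DSVM.fastRate n K ≤ |Λ| * DSVM.fastRate n K := by
      gcongr; exact le_abs_self Λ
    rw [mul_div_right_comm] at h1
    linarith [hLm.1]
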